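/- **Setting.** Let $n,p\ge 1$ be integers, $L=(L_1,\dots,L_p)$ with all $L_j>0$, $L_{\min}=\min_j L_j$, $L_{\max}=\max_j L_j$, $\beta>0$, and $\mathcal X=\prod_{j=1}^p\{-L_j,+L_j\}\subset\mathbb R^p$. For a dataset $D=(d_1,\dots,d_n)\in\mathcal X^n$ with $\sum_i d_i\neq 0$ put $\ell(w;d)=-\langle w,d\rangle$, $\psi_D(w)=\frac{\|\sum_i d_i\|_2}{2\beta n}\|w\|_2^2$ and $$F(w;D)=\frac1n\sum_{i=1}^n \ell(w;d_i)+\psi_D(w)=-\frac1n\Big\langle w,\sum_{i=1}^n d_i\Big\rangle+\frac{\|\sum_{i=1}^n d_i\|_2}{2\beta n}\|w\|_2^2,\qquad w\in\mathbb R^p .$$ This is a composite ERM problem whose loss $\ell(\cdot;d)$ is, for every $d \in \mathcal X$, convex, smooth and $L$-component-Lipschitz (that is, $|\ell(w+te_j;d)-\ell(w;d)|\le L_j|t|$ for all $w,t,j$), whose regularizer $\psi_D$ is convex and separable, and which has a minimizer $w^*$ with $\|w^*\|_2=\beta$. A randomized algorithm $\mathcal A:\mathcal X^n\to\mathbb R^p$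 is $(\epsilon,\delta)$-differentially private if $\Pr[\mathcal A(D)\in S]\le e^{\epsilon}\Pr[\mathcal A(D')\in S]+\delta$ for all measurable $S\subseteq\mathbb R^p$ and all $D,D'\in\mathcal X^n$ that differ in at most one record. **Statement.** Let $\epsilon_0>0$. 1. For every $\kappa>0$ there are constants $c,c'>0$, depending only on $\epsilon_0$ and $\kappa$, such that the following holds for all $n,p\ge1$, $\beta>0$, $0<\epsilon\le\epsilon_0$, $0\le\delta\le c'/n$ and all $L$ that satisfy $\sqrt{\sum_{j\in\mathcal J}L_j^2}\ge\kappa\|L\|_2$ for every $\mathcal J\subseteq\{1,\dots,p\}$ with at least $\lceil p/75\rceil$ elements. For every $(\epsilon,\delta)$-differentially private algorithm $\mathcal A:\mathcal X^n\to\mathbb R^p$ there is a dataset $D\in\mathcal X^n$ with $\sum_i d_i\ne0$ such that $$\mathbb E\big[F(\mathcal A(D);D)-F(w^*;D)\big]\ \ge\ c\,\min\Big(\|L\|_2\,\beta,\ \frac{\beta\,\|L\|_2\sqrt p}{n\epsilon}\Big).$$ 2. Without the assumption on the subsets $\mathcal J$, there are constants $c,c'>0$, depending only on $\epsilon_0$,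 such that for all $n,p\ge1$, $L$, $\beta>0$, $0<\epsilon\le\epsilon_0$, $0\le\delta\le c'/n$ and every $(\epsilon,\delta)$-differentially private $\mathcal A:\mathcal X^n\to\mathbb R^p$ there is a dataset $D\in\mathcal X^n$ with $\sum_i d_i\ne0$ such that $$\mathbb E\big[F(\mathcal A(D);D)-F(w^*;D)\big]\ \ge\ c\,\frac{L_{\min}}{L_{\max}}\min\Big(\|L\|_2\,\beta,\ \frac{\beta\,\|L\|_2\sqrt p}{n\epsilon}\Big).$$ In particular both bounds hold, for all sufficiently large $n$, for any $\delta=\delta(n)=o(1/n)$. -/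

import Mathlib

open MeasureTheory

/-- A randomized algorithm, given by the law of its output on each dataset of `n` records, is
`(ε, δ)`-differentially private: for datasets that differ in at most one record and every
measurable set `S` of outcomes, `P[A(D) ∈ S] ≤ exp(ε) P[A(D') ∈ S] + δ`. -/
def IsDifferentiallyPrivate {n : ℕ} {X W : Type*} [MeasurableSpace W]
    (ε δ : ℝ) (A : (Fin n → X) → ProbabilityMeasure W) : Prop :=
  ∀ D D' : Fin n → X, (∃ i, ∀ j, j ≠ i → D j = D' j) →
    ∀ S : Set W, MeasurableSet S →
      (A D : Measure W) S ≤
        ENNReal.ofReal (Real.exp ε) * (A D' : Measure W) S + ENNReal.ofReal δ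

/-- `|f(w + t e_j) - f(w)| ≤ L_j |t|` for all `w`, `t`, `j`. -/
def ComponentLipschitz {p : ℕ} (L : EuclideanSpace ℝ (Fin p))
    (f : EuclideanSpace ℝ (Fin p) → ℝ) : Prop :=
  ∀ (w : EuclideanSpace ℝ (Fin p)) (t : ℝ) (j : Fin p),
    |f (w + t • EuclideanSpace.single j (1 : ℝ)) - f w| ≤ L j * |t|

/-- `f` is differentiable and `f(w) ≤ f(v) + ⟨∇f(v), w - v⟩ + ½ ‖w - v‖_M²` for all `v`, `w`. -/
def ComponentSmooth {p : ℕ} (M : EuclideanSpace ℝ (Fin p))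
    (f : EuclideanSpace ℝ (Fin p) → ℝ) : Prop :=
  Differentiable ℝ f ∧ ∀ v w : EuclideanSpace ℝ (Fin p),
    f w ≤ f v + inner ℝ (gradient f v) (w - v) + 1 / 2 * ∑ j, M j * (w j - v j) ^ 2

/-- `ψ(w) = ∑ⱼ ψⱼ(wⱼ)`. -/
def IsCoordSeparable {p : ℕ} (ψ : EuclideanSpace ℝ (Fin p) → ℝ) : Prop :=
  ∃ φ : Fin p → ℝ → ℝ, ∀ w, ψ w = ∑ j, φ j (w j)

/-- The composite objective `F(w; D) = (1/n) ∑ᵢ ℓ(w; dᵢ) + ψ(w)`. -/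
noncomputable def compositeObjective {n p : ℕ} {X : Type*}
    (ℓ : EuclideanSpace ℝ (Fin p) → X → ℝ) (ψ : EuclideanSpace ℝ (Fin p) → ℝ)
    (D : Fin n → X) (w : EuclideanSpace ℝ (Fin p)) : ℝ :=
  1 / (n : ℝ) * ∑ i, ℓ w (D i) + ψ w

/-- The class of composite ERM problems under consideration: the loss is convex, component-smooth
and `L`-component-Lipschitz in `w` for every record, and the regularizer is convex and
separable. -/
structure IsCompositeERM {p : ℕ} {X : Type*} (L : EuclideanSpace ℝ (Fin p))
    (ℓ : EuclideanSpace ℝ (Fin p) → X → ℝ) (ψ : EuclideanSpace ℝ (Fin p) → ℝ) : Prop where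
  loss_convex : ∀ d, ConvexOn ℝ Set.univ (fun w => ℓ w d)
  loss_smooth : ∃ M : EuclideanSpace ℝ (Fin p), (∀ j, 0 < M j) ∧
    ∀ d, ComponentSmooth M (fun w => ℓ w d)
  loss_lipschitz : ∀ d, ComponentLipschitz L (fun w => ℓ w d)
  reg_convex : ConvexOn ℝ Set.univ ψ
  reg_separable : IsCoordSeparable ψ

/-- The set of records `∏ⱼ {-Lⱼ, Lⱼ}`. -/
def signBox {p : ℕ} (L : EuclideanSpace ℝ (Fin p)) : Set (EuclideanSpace ℝ (Fin p)) :=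
  {d | ∀ j, d j = L j ∨ d j = -L j}

/-- The linear loss `ℓ(w; d) = -⟨w, d⟩`. -/
noncomputable def linearLoss {p : ℕ} (L : EuclideanSpace ℝ (Fin p))
    (w : EuclideanSpace ℝ (Fin p)) (d : signBox L) : ℝ :=
  -inner ℝ w (d : EuclideanSpace ℝ (Fin p))

/-- The regularizer `ψ(w) = ‖∑ᵢ dᵢ‖₂ / (2 β n) * ‖w‖₂²`. -/
noncomputable def ridgeRegularizer {n p : ℕ} {L : EuclideanSpace ℝ (Fin p)} (β : ℝ)
    (D : Fin n → signBox L) (w : EuclideanSpace ℝ (Fin p)) : ℝ :=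
  ‖∑ i, (D i : EuclideanSpace ℝ (Fin p))‖ / (2 * β * n) * ‖w‖ ^ 2

/-- Every set of at least `⌈p / 75⌉` coordinates carries at least `κ ‖L‖₂` of the norm. -/
def IsSpread {p : ℕ} (κ : ℝ) (L : EuclideanSpace ℝ (Fin p)) : Prop :=
  ∀ J : Finset (Fin p), ⌈(p : ℝ) / 75⌉₊ ≤ J.card → κ * ‖L‖ ≤ √(∑ j ∈ J, L j ^ 2)

/-- `D` has a nonzero sum, and gives a composite ERM problem (linear loss, `ℓ₂`-regularizer) which
has a minimizer `w⋆`, of norm `β`, and on which the expected excess risk of the algorithm `A`,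
`E[F(A(D); D) - F(w⋆; D)]` (a Lebesgue integral, `∞` allowed), is at least `r`. -/
def IsHardInstance {n p : ℕ} (L : EuclideanSpace ℝ (Fin p)) (β : ℝ)
    (A : (Fin n → signBox L) → ProbabilityMeasure (EuclideanSpace ℝ (Fin p)))
    (D : Fin n → signBox L) (r : ℝ) : Prop :=
  ∑ i, (D i : EuclideanSpace ℝ (Fin p)) ≠ 0 ∧
  IsCompositeERM L (linearLoss L) (ridgeRegularizer β D) ∧
  ∃ wstar : EuclideanSpace ℝ (Fin p),
    IsMinOn (compositeObjective (linearLoss L) (ridgeRegularizer β D) D) Set.univ wstar ∧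
    ‖wstar‖ = β ∧
    ENNReal.ofReal r ≤
      ∫⁻ w, ENNReal.ofReal
        (compositeObjective (linearLoss L) (ridgeRegularizer β D) D w -
          compositeObjective (linearLoss L) (ridgeRegularizer β D) D wstar)
        ∂(A D : Measure (EuclideanSpace ℝ (Fin p)))

/-! With `u = w / β` and `s = ∑ dᵢ`, the excess risk is `β / (2n)` times `‖s‖(1 + ‖u‖²) - 2⟨u, s⟩`.
Small risk therefore forces the output to correlate with the coordinate sums of the data, and
privacy limits this correlation.

The limit is a fingerprinting argument. In each coordinate independently, the signs of `m` records
follow a Pólya urn. The sign sum `S` is then typically of order `m`, while the mean of one sign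
given the others is a multiple of the sum of the others, so the residuals `rᵢ` add up to `2S/(m+1)`.
For a bounded output `g` and weights `|aⱼ| ≤ M`, the score `∑ⱼ aⱼ rᵢ(Xⱼ) gⱼ` has mean zero and
second moment at most `16M²` when `g` is computed without record `i`. By `integral_le_of_private`,
on the true data its mean is at most `(exp ε - 1)·4M + 8δ‖a‖`. Summing over `i` gives
`fingerprinting`.

Take `a = L` on a set `J` of coordinates of comparable size and `a = 0` elsewhere. Small risk would
need correlation of order `m‖a‖`, which is impossible while `mεM ≪ ‖a‖` and `mδ ≪ 1`; this allows
`m` of order `min(n, √|J|/ε)` (`exists_le_lintegral_scaledRisk_urnData`). The other signs alternate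
and perturb `s` by `O(‖L‖)`. When this is not negligible, the target itself is `O(‖L‖)`, and two
datasets with opposite sums, two record changes apart, suffice
(`exists_norm_le_lintegral_scaledRisk`).

For spread `L`, half of the coordinates are of order `‖L‖/√p` and form `J`. In general a dyadic
level set serves, at the price of the factor `Lmin/Lmax`. -/

/-! ### Expectations under `(ε, δ)`-close laws -/

theorem lintegral_le_of_forall_measure_le {Ω : Type*} [MeasurableSpace Ω] {μ ν : Measure Ω}
    {C d : ENNReal} (hμν : ∀ S, MeasurableSet S → μ S ≤ C * ν S + d)
    {f : Ω → ℝ} (hf : Measurable f) (hf0 : ∀ x, 0 ≤ f x) {B : ℝ} (hfB : ∀ x, f x ≤ B) :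
    ∫⁻ x, ENNReal.ofReal (f x) ∂μ ≤
      C * ∫⁻ x, ENNReal.ofReal (f x) ∂ν + d * ENNReal.ofReal B := by
  have hanti : Measurable fun t : ℝ => ν {x | t < f x} :=
    Antitone.measurable fun s t hst => measure_mono fun x hx => lt_of_le_of_lt hst hx
  -- Layer-cake formula: tails beyond `B` are empty, so the additive error is integrated over `(0,
  -- B)` only.
  have key : ∀ t : ℝ, μ {x | t < f x} ≤ C * ν {x | t < f x} + (Set.Iio B).indicator (fun _ => d) t := by
    intro t
    by_cases ht : t < B
    · simpa [ht] using hμν _ (measurableSet_lt measurable_const hf)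
    · have : {x | t < f x} = ∅ := by
        ext x; simpa using (hfB x).trans (not_lt.1 ht)
      simp [this]
  rw [lintegral_eq_lintegral_meas_lt μ (.of_forall hf0) hf.aemeasurable,
    lintegral_eq_lintegral_meas_lt ν (.of_forall hf0) hf.aemeasurable]
  refine (lintegral_mono key).trans ?_
  rw [lintegral_add_left (hanti.const_mul C), lintegral_const_mul _ hanti,
    lintegral_indicator measurableSet_Iio]
  gcongr
  rw [setLIntegral_const, Measure.restrict_apply measurableSet_Iio]
  gcongr
  refine (measure_mono (t := Set.Ioo 0 B) fun x hx => ⟨hx.2, hx.1⟩).trans ?_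
  simp

theorem integral_le_of_forall_measure_le {Ω : Type*} [MeasurableSpace Ω] {μ ν : Measure Ω}
    [IsProbabilityMeasure μ] [IsProbabilityMeasure ν]
    {C d : ℝ} (hC : 0 ≤ C) (hd : 0 ≤ d)
    (hμν : ∀ S, MeasurableSet S → μ S ≤ ENNReal.ofReal C * ν S + ENNReal.ofReal d)
    {f : Ω → ℝ} (hf : Measurable f) (hf0 : ∀ x, 0 ≤ f x) {B : ℝ} (hB : 0 ≤ B)
    (hfB : ∀ x, f x ≤ B) :
    ∫ x, f x ∂μ ≤ C * ∫ x, f x ∂ν + d * B := by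
  have h := lintegral_le_of_forall_measure_le hμν hf hf0 hfB
  have hint : ∀ (ρ : Measure Ω) [IsProbabilityMeasure ρ], Integrable f ρ := fun ρ _ =>
    Integrable.of_bound hf.aestronglyMeasurable B
      (.of_forall fun x => by rw [Real.norm_of_nonneg (hf0 x)]; exact hfB x)
  rw [← ofReal_integral_eq_lintegral_ofReal (hint μ) (.of_forall hf0),
    ← ofReal_integral_eq_lintegral_ofReal (hint ν) (.of_forall hf0),
    ← ENNReal.ofReal_mul hC, ← ENNReal.ofReal_mul hd,
    ← ENNReal.ofReal_add (mul_nonneg hC (integral_nonneg hf0)) (mul_nonneg hd hB)] at h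
  exact (ENNReal.ofReal_le_ofReal_iff
    (add_nonneg (mul_nonneg hC (integral_nonneg hf0)) (mul_nonneg hd hB))).1 h

/-- Expectations of a bounded function under two `(ε, δ)`-close laws. -/
theorem integral_le_of_private {Ω : Type*} [MeasurableSpace Ω] {μ ν : Measure Ω}
    [IsProbabilityMeasure μ] [IsProbabilityMeasure ν] {ε δ : ℝ} (hε : 0 ≤ ε) (hδ : 0 ≤ δ)
    (hμν : ∀ S, MeasurableSet S →
      μ S ≤ ENNReal.ofReal (Real.exp ε) * ν S + ENNReal.ofReal δ)
    (hνμ : ∀ S, MeasurableSet S →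
      ν S ≤ ENNReal.ofReal (Real.exp ε) * μ S + ENNReal.ofReal δ)
    {h : Ω → ℝ} (hh : Measurable h) {B : ℝ} (hB : ∀ x, |h x| ≤ B) :
    ∫ x, h x ∂μ ≤ ∫ x, h x ∂ν + (Real.exp ε - 1) * ∫ x, |h x| ∂ν + 2 * δ * B := by
  have hint : ∀ (ρ : Measure Ω) [IsProbabilityMeasure ρ] (f : Ω → ℝ), Measurable f →
      (∀ x, |f x| ≤ B) → Integrable f ρ := fun ρ _ f hf hfB =>
    Integrable.of_bound hf.aestronglyMeasurable B (.of_forall hfB)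
  obtain ⟨x₀⟩ : Nonempty Ω := nonempty_of_isProbabilityMeasure μ
  have hB0 : 0 ≤ B := (abs_nonneg _).trans (hB x₀)
  set f : Ω → ℝ := fun x => max (h x) 0 with hfdef
  set g : Ω → ℝ := fun x => max (-h x) 0 with hgdef
  have hfm : Measurable f := hh.max measurable_const
  have hgm : Measurable g := hh.neg.max measurable_const
  have hf0 : ∀ x, 0 ≤ f x := fun x => le_max_right _ _
  have hg0 : ∀ x, 0 ≤ g x := fun x => le_max_right _ _
  have hfB : ∀ x, f x ≤ B := fun x => max_le ((le_abs_self _).trans (hB x)) hB0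
  have hgB : ∀ x, g x ≤ B := fun x => max_le ((neg_le_abs _).trans (hB x)) hB0
  have hsub : ∀ x, h x = f x - g x := fun x => by
    simp only [hfdef, hgdef]; rcases le_total (h x) 0 with H | H <;> simp [H]
  have habs : ∀ x, |h x| = f x + g x := fun x => by
    simp only [hfdef, hgdef]
    rcases le_total (h x) 0 with H | H
    · simp [H, abs_of_nonpos H]
    · simp [H, abs_of_nonneg H]
  have hfi : ∀ (ρ : Measure Ω) [IsProbabilityMeasure ρ], Integrable f ρ := fun ρ _ =>
    hint ρ f hfm fun x => by rw [abs_of_nonneg (hf0 x)]; exact hfB x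
  have hgi : ∀ (ρ : Measure Ω) [IsProbabilityMeasure ρ], Integrable g ρ := fun ρ _ =>
    hint ρ g hgm fun x => by rw [abs_of_nonneg (hg0 x)]; exact hgB x
  have h1 := integral_le_of_forall_measure_le (Real.exp_pos ε).le hδ hμν hfm hf0 hB0 hfB
  have h2 := integral_le_of_forall_measure_le (Real.exp_pos ε).le hδ hνμ hgm hg0 hB0 hgB
  simp only [habs]
  simp only [hsub]
  rw [integral_sub (hfi μ) (hgi μ), integral_sub (hfi ν) (hgi ν), integral_add (hfi ν) (hgi ν)]
  have he : 1 ≤ Real.exp ε := Real.one_le_exp hε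
  have hg1 : 0 ≤ ∫ x, g x ∂ν := integral_nonneg hg0
  have hg2 : 0 ≤ ∫ x, g x ∂μ := integral_nonneg hg0
  have hdB : 0 ≤ δ * B := mul_nonneg hδ hB0
  by_cases hc : ∫ x, g x ∂ν - δ * B ≤ 0
  · nlinarith
  · push Not at hc
    -- The negative part needs a lower bound under `μ`, hence the reversed closeness; it is used
    -- through `(2 - exp ε) exp ε ≤ 1`.
    have : (2 - Real.exp ε) * (∫ x, g x ∂ν) ≤ ∫ x, g x ∂μ + δ * B := by
      by_cases h3 : 2 - Real.exp ε ≤ 0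
      · nlinarith
      · push Not at h3
        have h4 := mul_le_mul_of_nonneg_left h2 h3.le
        nlinarith [mul_nonneg hg2 (sq_nonneg (Real.exp ε - 1)), mul_nonneg hdB (sub_nonneg.2 he)]
    nlinarith

/-! ### The Pólya urn and its residuals -/

/-- The sign of the record `i` when `x` is the set of records with a plus sign. -/
noncomputable def recordSign {m : ℕ} (x : Finset (Fin m)) (i : Fin m) : ℝ := if i ∈ x then 1 else -1

/-- The sum of all signs. -/
noncomputable def signSum {m : ℕ} (x : Finset (Fin m)) : ℝ := 2 * (x.card : ℝ) - m

/-- The law of `m` draws from a Pólya urn started with one ball of each sign. -/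
noncomputable def urnWeight {m : ℕ} (x : Finset (Fin m)) : ℝ :=
  (((m : ℝ) + 1) * (m.choose x.card : ℝ))⁻¹

/-- The sign of record `i` minus its conditional mean given the other records. -/
noncomputable def urnResidual {m : ℕ} (i : Fin m) (x : Finset (Fin m)) : ℝ :=
  recordSign x i - (signSum x - recordSign x i) / (m + 1)

/-- Flip the sign of record `i`. -/
def toggle {m : ℕ} (i : Fin m) (x : Finset (Fin m)) : Finset (Fin m) :=
  if i ∈ x then x.erase i else insert i x

theorem toggle_involutive {m : ℕ} (i : Fin m) : Function.Involutive (toggle i) := by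
  intro x
  by_cases h : i ∈ x <;> simp [toggle, h]

theorem toggle_erase {m : ℕ} (i : Fin m) (x : Finset (Fin m)) :
    (toggle i x).erase i = x.erase i := by
  by_cases h : i ∈ x <;> simp [toggle, h]

theorem sum_recordSign {m : ℕ} (x : Finset (Fin m)) : ∑ i, recordSign x i = signSum x := by
  have : ∀ i, recordSign x i = 2 * (if i ∈ x then 1 else 0) - 1 := fun i => by
    by_cases h : i ∈ x <;> simp [recordSign, h]; norm_num
  simp [this, signSum, mul_comm]

theorem abs_recordSign {m : ℕ} (x : Finset (Fin m)) (i : Fin m) : |recordSign x i| = 1 := by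
  by_cases h : i ∈ x <;> simp [recordSign, h]

theorem abs_signSum_le {m : ℕ} (x : Finset (Fin m)) : |signSum x| ≤ m := by
  rw [← sum_recordSign]
  refine (Finset.abs_sum_le_sum_abs _ _).trans ?_
  simp [abs_recordSign]

theorem abs_urnResidual_le {m : ℕ} (i : Fin m) (x : Finset (Fin m)) : |urnResidual i x| ≤ 2 := by
  have h1 := abs_recordSign x i
  have h2 : |(signSum x - recordSign x i) / (m + 1)| ≤ 1 := by
    rw [abs_div, abs_of_pos (by positivity : (0 : ℝ) < m + 1), div_le_one (by positivity)]
    refine (abs_sub _ _).trans ?_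
    rw [h1]; linarith [abs_signSum_le x]
  refine (abs_sub _ _).trans ?_
  linarith

/-- The reason for choosing the urn: its conditional means are linear in the other signs, so the
residuals recombine into the sign sum itself. -/
theorem sum_urnResidual {m : ℕ} (x : Finset (Fin m)) :
    ∑ i, urnResidual i x = 2 / (m + 1) * signSum x := by
  simp only [urnResidual, Finset.sum_sub_distrib, ← Finset.sum_div, sum_recordSign]
  simp
  field_simp
  ring

theorem urnWeight_pos {m : ℕ} (x : Finset (Fin m)) : 0 < urnWeight x := by
  have : 0 < m.choose x.card := Nat.choose_pos (by simpa using x.card_le_univ)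
  unfold urnWeight
  positivity

/-- Expresses that the residual has mean zero given the other records. It comes down to `(k+1)
C(m,k+1) = (m-k) C(m,k)`. -/
theorem urnWeight_mul_urnResidual_insert {m : ℕ} {i : Fin m} {x : Finset (Fin m)} (h : i ∉ x) :
    urnWeight (insert i x) * urnResidual i (insert i x) = -(urnWeight x * urnResidual i x) := by
  have hc : x.card < m := by
    have := (Finset.card_lt_univ_of_notMem h); simpa using this
  have h1 : 0 < m.choose x.card := Nat.choose_pos hc.le
  have h2 : 0 < m.choose (x.card + 1) := Nat.choose_pos hc
  have h3 := Nat.choose_succ_right_eq m x.card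
  have h3' : (m.choose (x.card + 1) : ℝ) * (x.card + 1) = m.choose x.card * (m - x.card) := by
    have := congrArg (Nat.cast (R := ℝ)) h3
    rwa [Nat.cast_mul, Nat.cast_mul, Nat.cast_sub hc.le, Nat.cast_add, Nat.cast_one] at this
  simp only [urnWeight, urnResidual, recordSign, signSum, Finset.card_insert_of_notMem h, h,
    Finset.mem_insert_self, if_true, if_false]
  have h1' : (0 : ℝ) < m.choose x.card := by exact_mod_cast h1
  have h2' : (0 : ℝ) < m.choose (x.card + 1) := by exact_mod_cast h2
  push_cast
  field_simp
  linear_combination (-2 : ℝ) * h3'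

theorem urnWeight_mul_urnResidual_toggle {m : ℕ} (i : Fin m) (x : Finset (Fin m)) :
    urnWeight (toggle i x) * urnResidual i (toggle i x) = -(urnWeight x * urnResidual i x) := by
  by_cases h : i ∈ x
  · have := urnWeight_mul_urnResidual_insert (Finset.notMem_erase i x)
    rw [Finset.insert_erase h] at this
    simp [toggle, h, this]
  · simpa [toggle, h] using urnWeight_mul_urnResidual_insert h

/-- The number of plus signs is uniform on `0, …, m`: the binomial coefficient in the weight cancels
the number of sets of a given size. -/
theorem sum_urnWeight_mul_card {m : ℕ} (f : ℕ → ℝ) :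
    ∑ x : Finset (Fin m), urnWeight x * f x.card =
      (∑ k ∈ Finset.range (m + 1), f k) / (m + 1) := by
  have := Finset.sum_powerset_apply_card
    (fun k => (((m : ℝ) + 1) * (m.choose k : ℝ))⁻¹ * f k) (x := (Finset.univ : Finset (Fin m)))
  simp only [Finset.powerset_univ, Finset.card_univ, Fintype.card_fin] at this
  simp only [urnWeight]
  rw [this, Finset.sum_div]
  refine Finset.sum_congr rfl fun k hk => ?_
  have : 0 < m.choose k := Nat.choose_pos (by simpa [Nat.lt_succ_iff] using hk)
  have : (0 : ℝ) < m.choose k := by exact_mod_cast this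
  rw [nsmul_eq_mul]
  field_simp

theorem sum_urnWeight (m : ℕ) : ∑ x : Finset (Fin m), urnWeight x = 1 := by
  have := sum_urnWeight_mul_card (m := m) (fun _ => 1)
  simp only [mul_one] at this
  rw [this]
  have h : (m : ℝ) + 1 ≠ 0 := by positivity
  simp [h]

theorem sum_range_sq_sub (a : ℝ) (n : ℕ) :
    ∑ k ∈ Finset.range n, (2 * (k : ℝ) - a) ^ 2 =
      2 * (n * (n - 1) * (2 * n - 1)) / 3 - 2 * a * (n * (n - 1)) + n * a ^ 2 := by
  induction n with
  | zero => simp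
  | succ n ih => rw [Finset.sum_range_succ, ih]; push_cast; ring

/-- The second moment of the sign sum is `m(m+2)/3`, and `|S| ≤ m` gives `S² ≤ m|S|`. -/
theorem sum_urnWeight_mul_abs_signSum (m : ℕ) :
    (m : ℝ) / 3 ≤ ∑ x : Finset (Fin m), urnWeight x * |signSum x| := by
  rcases Nat.eq_zero_or_pos m with rfl | hm
  · simp [signSum, Finset.eq_empty_of_isEmpty]
  have hm' : (0 : ℝ) < m := by exact_mod_cast hm
  have h1 := sum_urnWeight_mul_card (m := m) (fun k => (2 * (k : ℝ) - m) ^ 2)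
  rw [sum_range_sq_sub] at h1
  have h2 : ∑ x : Finset (Fin m), urnWeight x * (2 * (x.card : ℝ) - m) ^ 2 ≤
      m * ∑ x : Finset (Fin m), urnWeight x * |signSum x| := by
    rw [Finset.mul_sum]
    refine Finset.sum_le_sum fun x _ => ?_
    have h3 := abs_signSum_le x
    have h4 := urnWeight_pos x
    have h5 : (2 * (x.card : ℝ) - m) ^ 2 = |signSum x| * |signSum x| := by
      rw [abs_mul_abs_self, signSum]; ring
    rw [h5]
    have := mul_le_mul_of_nonneg_right h3 (abs_nonneg (signSum x))
    nlinarith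
  rw [h1] at h2
  push_cast at h2
  have h6 : (m : ℝ) * (m / 3) ≤ m * ∑ x : Finset (Fin m), urnWeight x * |signSum x| := by
    refine le_trans ?_ h2
    rw [le_div_iff₀ (by positivity)]
    nlinarith
  exact le_of_mul_le_mul_left h6 hm'

/-! ### Product law, scores and fingerprinting -/

/-- The product law: independent urns for the coordinates. -/
noncomputable def urnProd {m : ℕ} {K : Type*} [Fintype K] (X : K → Finset (Fin m)) : ℝ :=
  ∏ j, urnWeight (X j)

theorem urnProd_pos {m : ℕ} {K : Type*} [Fintype K] (X : K → Finset (Fin m)) : 0 < urnProd X :=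
  Finset.prod_pos fun j _ => urnWeight_pos (X j)

theorem sum_urnProd_mul {m : ℕ} {K : Type*} [Fintype K] [DecidableEq K] (k : K)
    (f : Finset (Fin m) → ℝ) :
    ∑ X : K → Finset (Fin m), urnProd X * f (X k) = ∑ x, urnWeight x * f x := by
  have h := Finset.prod_univ_sum (fun _ : K => (Finset.univ : Finset (Finset (Fin m))))
    (fun j x => urnWeight x * if j = k then f x else 1)
  rw [Fintype.piFinset_univ] at h
  simp only [Finset.prod_mul_distrib, Finset.prod_ite_eq', Finset.mem_univ, if_true] at h
  simp only [urnProd]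
  rw [← h, Finset.prod_eq_single k]
  · simp
  · intro j _ hj
    simp [hj, sum_urnWeight]
  · simp

theorem sum_urnProd {m : ℕ} {K : Type*} [Fintype K] [DecidableEq K] :
    ∑ X : K → Finset (Fin m), urnProd X = 1 := by
  have h := Finset.prod_univ_sum (fun _ : K => (Finset.univ : Finset (Finset (Fin m))))
    (fun _ x => urnWeight x)
  rw [Fintype.piFinset_univ] at h
  simp only [urnProd]
  rw [← h]
  simp [sum_urnWeight]

/-- Flipping the sign of record `i` in coordinate `k` pairs the terms with opposite values, since
`G` does not see that sign. -/
theorem sum_urnProd_mul_urnResidual {m : ℕ} {K : Type*} [Fintype K] [DecidableEq K] (k : K)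
    (i : Fin m) (G : (K → Finset (Fin m)) → ℝ)
    (hG : ∀ X, G (Function.update X k (toggle i (X k))) = G X) :
    ∑ X, urnProd X * (urnResidual i (X k) * G X) = 0 := by
  have hinv : Function.Involutive
      fun X : K → Finset (Fin m) => Function.update X k (toggle i (X k)) := by
    intro X
    simp [toggle_involutive i (X k)]
  have h := Equiv.sum_comp hinv.toPerm
    (fun X : K → Finset (Fin m) => urnProd X * (urnResidual i (X k) * G X))
  have hneg : ∀ X : K → Finset (Fin m),
      urnProd (Function.update X k (toggle i (X k))) *
        (urnResidual i (Function.update X k (toggle i (X k)) k) *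
          G (Function.update X k (toggle i (X k)))) =
      -(urnProd X * (urnResidual i (X k) * G X)) := by
    intro X
    rw [hG]
    have h1 : ∀ Y : K → Finset (Fin m),
        urnProd Y = urnWeight (Y k) * ∏ j ∈ Finset.univ.erase k, urnWeight (Y j) := fun Y =>
      (Finset.mul_prod_erase _ _ (Finset.mem_univ k)).symm
    have h2 : ∏ j ∈ Finset.univ.erase k,
        urnWeight (Function.update X k (toggle i (X k)) j) =
        ∏ j ∈ Finset.univ.erase k, urnWeight (X j) :=
      Finset.prod_congr rfl fun j hj => by
        rw [Function.update_of_ne (Finset.ne_of_mem_erase hj)]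
    rw [h1, h1 X, h2, Function.update_self]
    linear_combination (G X * ∏ j ∈ Finset.univ.erase k, urnWeight (X j)) *
      urnWeight_mul_urnResidual_toggle i (X k)
  simp only [Function.Involutive.coe_toPerm, hneg, Finset.sum_neg_distrib] at h
  linarith

/-- Score functional of record `i`. -/
noncomputable def urnScore {m : ℕ} {K Ω : Type*} [Fintype K] (a : K → ℝ) (g : K → Ω → ℝ)
    (i : Fin m) (X : K → Finset (Fin m)) (w : Ω) : ℝ :=
  ∑ j, a j * urnResidual i (X j) * g j w

/-- Cauchy–Schwarz. This crude bound grows with `‖a‖`, so it is spent only on the `δ` term; the `ε`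
term uses the second moment. -/
theorem abs_urnScore_le {m : ℕ} {K Ω : Type*} [Fintype K] (a : K → ℝ) (g : K → Ω → ℝ)
    (hg : ∀ w, ∑ j, g j w ^ 2 ≤ 4) (i : Fin m) (X : K → Finset (Fin m)) (w : Ω) :
    |urnScore a g i X w| ≤ 4 * √(∑ j, a j ^ 2) := by
  refine abs_le_of_sq_le_sq ?_ (by positivity)
  have h1 : ∑ j, (a j * urnResidual i (X j)) ^ 2 ≤ 4 * ∑ j, a j ^ 2 := by
    rw [Finset.mul_sum]
    refine Finset.sum_le_sum fun j _ => ?_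
    have : urnResidual i (X j) ^ 2 ≤ 4 := by
      have := sq_le_sq' (by linarith [neg_abs_le (urnResidual i (X j)), abs_urnResidual_le i (X j)])
        ((le_abs_self _).trans (abs_urnResidual_le i (X j)))
      linarith
    nlinarith [sq_nonneg (a j)]
  calc urnScore a g i X w ^ 2 ≤ (∑ j, (a j * urnResidual i (X j)) ^ 2) * ∑ j, g j w ^ 2 :=
        Finset.sum_mul_sq_le_sq_mul_sq _ _ _
    _ ≤ (4 * ∑ j, a j ^ 2) * 4 :=
        mul_le_mul h1 (hg w) (Finset.sum_nonneg fun j _ => sq_nonneg _)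
          (by positivity)
    _ = (4 * √(∑ j, a j ^ 2)) ^ 2 := by
        rw [mul_pow, Real.sq_sqrt (Finset.sum_nonneg fun j _ => sq_nonneg _)]; ring

theorem erase_update_toggle {m : ℕ} {K : Type*} [DecidableEq K] (i : Fin m)
    (X : K → Finset (Fin m)) (k : K) :
    (fun j => (Function.update X k (toggle i (X k)) j).erase i) = fun j => (X j).erase i := by
  funext j
  by_cases h : j = k
  · subst h; simp [toggle_erase]
  · simp [h]

theorem abs_le_two_of_sum_sq_le {K Ω : Type*} [Fintype K] (g : K → Ω → ℝ)
    (hg : ∀ w, ∑ j, g j w ^ 2 ≤ 4) (j : K) (w : Ω) : |g j w| ≤ 2 := by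
  refine abs_le_of_sq_le_sq ?_ (by norm_num)
  have h1 := Finset.single_le_sum (f := fun j => g j w ^ 2) (fun j _ => sq_nonneg _)
    (Finset.mem_univ j)
  have h2 := hg w
  linarith

theorem integrable_of_measurable_of_abs_le {Ω : Type*} [MeasurableSpace Ω] (ν : Measure Ω)
    [IsProbabilityMeasure ν] {f : Ω → ℝ} (hf : Measurable f) {B : ℝ} (hB : ∀ x, |f x| ≤ B) :
    Integrable f ν :=
  Integrable.of_bound hf.aestronglyMeasurable B (.of_forall hB)

section
variable {m : ℕ} {K Ω : Type*} [Fintype K] [DecidableEq K] [MeasurableSpace Ω]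

/-- Erasing record `i` makes the law of the output blind to that record's signs, so each residual
averages out. -/
theorem sum_urnProd_mul_integral_urnScore_erase
    (μ : (K → Finset (Fin m)) → Measure Ω) [∀ X, IsProbabilityMeasure (μ X)]
    (g : K → Ω → ℝ) (hgm : ∀ j, Measurable (g j)) (hg : ∀ w, ∑ j, g j w ^ 2 ≤ 4)
    (a : K → ℝ) (i : Fin m) :
    ∑ X, urnProd X * ∫ w, urnScore a g i X w ∂(μ fun j => (X j).erase i) = 0 := by
  have hgi : ∀ (j : K) (ν : Measure Ω) [IsProbabilityMeasure ν], Integrable (g j) ν :=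
    fun j ν _ => integrable_of_measurable_of_abs_le ν (hgm j) (abs_le_two_of_sum_sq_le g hg j)
  have h1 : ∀ X : K → Finset (Fin m), ∫ w, urnScore a g i X w ∂(μ fun j => (X j).erase i) =
      ∑ k, a k * (urnResidual i (X k) * ∫ w, g k w ∂(μ fun j => (X j).erase i)) := by
    intro X
    simp only [urnScore]
    rw [integral_finsetSum _ fun j _ => (hgi j _).const_mul _]
    exact Finset.sum_congr rfl fun k _ => by rw [integral_const_mul]; ring
  simp only [h1, Finset.mul_sum]
  rw [Finset.sum_comm]
  refine Finset.sum_eq_zero fun k _ => ?_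
  have h2 := sum_urnProd_mul_urnResidual k i
    (fun X => ∫ w, g k w ∂(μ fun j => (X j).erase i))
    (fun X => by rw [erase_update_toggle])
  calc _ = a k * ∑ X, urnProd X * (urnResidual i (X k) *
        ∫ w, g k w ∂(μ fun j => (X j).erase i)) := by
        rw [Finset.mul_sum]; exact Finset.sum_congr rfl fun X _ => by ring
    _ = 0 := by rw [h2, mul_zero]

/-- Residuals of distinct coordinates are orthogonal, so only the diagonal remains. There `aₖ² ≤
M²`, `r² ≤ 4` and `∑ gₖ² ≤ 4`: the bound is free of the dimension. -/
theorem sum_urnProd_mul_integral_urnScore_sq_erase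
    (μ : (K → Finset (Fin m)) → Measure Ω) [∀ X, IsProbabilityMeasure (μ X)]
    (g : K → Ω → ℝ) (hgm : ∀ j, Measurable (g j)) (hg : ∀ w, ∑ j, g j w ^ 2 ≤ 4)
    (a : K → ℝ) {M : ℝ} (ha : ∀ j, |a j| ≤ M) (i : Fin m) :
    ∑ X, urnProd X * ∫ w, urnScore a g i X w ^ 2 ∂(μ fun j => (X j).erase i) ≤ 16 * M ^ 2 := by
  have hb := abs_le_two_of_sum_sq_le g hg
  have hgi : ∀ (j k : K) (ν : Measure Ω) [IsProbabilityMeasure ν],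
      Integrable (fun w => g j w * g k w) ν :=
    fun j k ν _ => integrable_of_measurable_of_abs_le ν ((hgm j).mul (hgm k)) (B := 4) fun w => by
      rw [abs_mul]; nlinarith [hb j w, hb k w, abs_nonneg (g j w), abs_nonneg (g k w)]
  have h1 : ∀ X : K → Finset (Fin m), ∫ w, urnScore a g i X w ^ 2 ∂(μ fun j => (X j).erase i) =
      ∑ k, ∑ l, a k * a l * (urnResidual i (X k) * (urnResidual i (X l) *
        ∫ w, g k w * g l w ∂(μ fun j => (X j).erase i))) := by
    intro X
    have : ∀ w, urnScore a g i X w ^ 2 = ∑ k, ∑ l, (a k * a l * (urnResidual i (X k) *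
        urnResidual i (X l))) * (g k w * g l w) := fun w => by
      rw [urnScore, sq, Finset.sum_mul_sum]
      exact Finset.sum_congr rfl fun k _ => Finset.sum_congr rfl fun l _ => by ring
    simp only [this]
    rw [integral_finsetSum _ fun k _ => integrable_finsetSum _ fun l _ => (hgi k l _).const_mul _]
    refine Finset.sum_congr rfl fun k _ => ?_
    rw [integral_finsetSum _ fun l _ => (hgi k l _).const_mul _]
    exact Finset.sum_congr rfl fun l _ => by rw [integral_const_mul]; ring
  have hoff : ∀ k l, l ≠ k → ∑ X : K → Finset (Fin m), urnProd X *
      (a k * a l * (urnResidual i (X k) * (urnResidual i (X l) *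
        ∫ w, g k w * g l w ∂(μ fun j => (X j).erase i)))) = 0 := by
    intro k l hkl
    have h2 := sum_urnProd_mul_urnResidual k i
      (fun X => urnResidual i (X l) * ∫ w, g k w * g l w ∂(μ fun j => (X j).erase i))
      (fun X => by rw [erase_update_toggle, Function.update_of_ne hkl])
    calc _ = a k * a l * ∑ X : K → Finset (Fin m), urnProd X * (urnResidual i (X k) *
          (urnResidual i (X l) * ∫ w, g k w * g l w ∂(μ fun j => (X j).erase i))) := by
          rw [Finset.mul_sum]; exact Finset.sum_congr rfl fun X _ => by ring
      _ = 0 := by rw [h2, mul_zero]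
  have hdiag : ∑ X : K → Finset (Fin m), urnProd X *
      ∫ w, urnScore a g i X w ^ 2 ∂(μ fun j => (X j).erase i) =
      ∑ X : K → Finset (Fin m), urnProd X * ∑ k, a k * a k * (urnResidual i (X k) *
        (urnResidual i (X k) * ∫ w, g k w * g k w ∂(μ fun j => (X j).erase i))) := by
    simp only [h1, Finset.mul_sum (s := (Finset.univ : Finset K))]
    rw [Finset.sum_comm, Finset.sum_comm (s := (Finset.univ : Finset (K → Finset (Fin m))))]
    refine Finset.sum_congr rfl fun k _ => ?_
    rw [Finset.sum_comm, Finset.sum_eq_single k (fun l _ hl => hoff k l hl) (by simp)]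
  rw [hdiag]
  have hX : ∀ X : K → Finset (Fin m), ∑ k, a k * a k * (urnResidual i (X k) *
      (urnResidual i (X k) * ∫ w, g k w * g k w ∂(μ fun j => (X j).erase i))) ≤ 16 * M ^ 2 := by
    intro X
    have h3 : ∑ k, ∫ w, g k w * g k w ∂(μ fun j => (X j).erase i) ≤ 4 := by
      rw [← integral_finsetSum _ fun k _ => hgi k k _]
      calc ∫ w, ∑ k, g k w * g k w ∂(μ fun j => (X j).erase i)
          ≤ ∫ _, (4 : ℝ) ∂(μ fun j => (X j).erase i) :=
            integral_mono (integrable_finsetSum _ fun k _ => hgi k k _) (integrable_const _)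
              fun w => by simpa [sq] using hg w
        _ = 4 := by simp
    calc _ ≤ ∑ k, 4 * M ^ 2 * ∫ w, g k w * g k w ∂(μ fun j => (X j).erase i) := by
          refine Finset.sum_le_sum fun k _ => ?_
          have h4 : 0 ≤ ∫ w, g k w * g k w ∂(μ fun j => (X j).erase i) :=
            integral_nonneg fun w => mul_self_nonneg _
          have h5 : a k ^ 2 ≤ M ^ 2 := sq_le_sq' (by linarith [neg_abs_le (a k), ha k])
            ((le_abs_self _).trans (ha k))
          have h6 : urnResidual i (X k) ^ 2 ≤ 2 ^ 2 :=
            sq_le_sq' (by linarith [neg_abs_le (urnResidual i (X k)), abs_urnResidual_le i (X k)])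
              ((le_abs_self _).trans (abs_urnResidual_le i (X k)))
          have h7 : a k ^ 2 * urnResidual i (X k) ^ 2 ≤ M ^ 2 * 2 ^ 2 := by gcongr
          have := mul_le_mul_of_nonneg_right h7 h4
          nlinarith
      _ = 4 * M ^ 2 * ∑ k, ∫ w, g k w * g k w ∂(μ fun j => (X j).erase i) := by
          rw [Finset.mul_sum]
      _ ≤ 4 * M ^ 2 * 4 := by gcongr
      _ = 16 * M ^ 2 := by ring
  calc _ ≤ ∑ X : K → Finset (Fin m), urnProd X * (16 * M ^ 2) :=
        Finset.sum_le_sum fun X _ => mul_le_mul_of_nonneg_left (hX X) (urnProd_pos X).le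
    _ = 16 * M ^ 2 := by rw [← Finset.sum_mul, sum_urnProd, one_mul]

/-- The fingerprinting bound: the output of a private algorithm has little correlation with
the sign sums of its data. -/
theorem fingerprinting {ε δ : ℝ} (hε : 0 ≤ ε) (hδ : 0 ≤ δ)
    (μ : (K → Finset (Fin m)) → Measure Ω) [∀ X, IsProbabilityMeasure (μ X)]
    (hDP : ∀ (i : Fin m) (X Y : K → Finset (Fin m)),
      (∀ j, (X j).erase i = (Y j).erase i) → ∀ S, MeasurableSet S →
        μ X S ≤ ENNReal.ofReal (Real.exp ε) * μ Y S + ENNReal.ofReal δ)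
    (g : K → Ω → ℝ) (hgm : ∀ j, Measurable (g j)) (hg : ∀ w, ∑ j, g j w ^ 2 ≤ 4)
    (a : K → ℝ) {M : ℝ} (hM : 0 < M) (ha : ∀ j, |a j| ≤ M) :
    2 / (m + 1) * ∑ X : K → Finset (Fin m), urnProd X *
        ∑ j, a j * signSum (X j) * ∫ w, g j w ∂(μ X) ≤
      m * ((Real.exp ε - 1) * (4 * M) + 8 * δ * √(∑ j, a j ^ 2)) := by
  have hgi : ∀ (j : K) (ν : Measure Ω) [IsProbabilityMeasure ν], Integrable (g j) ν :=
    fun j ν _ => integrable_of_measurable_of_abs_le ν (hgm j) (abs_le_two_of_sum_sq_le g hg j)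
  have hsm : ∀ (i : Fin m) (X : K → Finset (Fin m)), Measurable (urnScore a g i X) := fun i X =>
    Finset.measurable_sum _ fun j _ => (hgm j).const_mul _
  have hsb := abs_urnScore_le (m := m) a g hg
  have hlhs : 2 / ((m : ℝ) + 1) * ∑ X : K → Finset (Fin m), urnProd X *
        ∑ j, a j * signSum (X j) * ∫ w, g j w ∂(μ X) =
      ∑ i : Fin m, ∑ X : K → Finset (Fin m), urnProd X * ∫ w, urnScore a g i X w ∂(μ X) := by
    rw [Finset.sum_comm, Finset.mul_sum]
    refine Finset.sum_congr rfl fun X _ => ?_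
    have : ∀ i : Fin m, ∫ w, urnScore a g i X w ∂(μ X) =
        ∑ j, a j * urnResidual i (X j) * ∫ w, g j w ∂(μ X) := fun i => by
      simp only [urnScore]
      rw [integral_finsetSum _ fun j _ => (hgi j _).const_mul _]
      exact Finset.sum_congr rfl fun k _ => by rw [integral_const_mul]
    simp only [this]
    rw [← Finset.mul_sum, Finset.sum_comm, mul_left_comm]
    congr 1
    rw [Finset.mul_sum]
    refine Finset.sum_congr rfl fun j _ => ?_
    rw [← Finset.sum_mul, ← Finset.mul_sum, sum_urnResidual]
    ring
  rw [hlhs]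
  have hi : ∀ i : Fin m, ∑ X : K → Finset (Fin m), urnProd X * ∫ w, urnScore a g i X w ∂(μ X) ≤
      (Real.exp ε - 1) * (4 * M) + 8 * δ * √(∑ j, a j ^ 2) := by
    intro i
    have he : 0 ≤ Real.exp ε - 1 := by linarith [Real.one_le_exp hε]
    have hX : ∀ X : K → Finset (Fin m), ∫ w, urnScore a g i X w ∂(μ X) ≤
        ∫ w, urnScore a g i X w ∂(μ fun j => (X j).erase i) +
        (Real.exp ε - 1) / (8 * M) * ∫ w, urnScore a g i X w ^ 2 ∂(μ fun j => (X j).erase i) +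
        ((Real.exp ε - 1) * (2 * M) + 8 * δ * √(∑ j, a j ^ 2)) := by
      intro X
      have h1 := integral_le_of_private hε hδ (hDP i X (fun j => (X j).erase i) (by simp))
        (hDP i (fun j => (X j).erase i) X (by simp)) (hsm i X) (hsb i X)
      have hsq : Integrable (fun w => urnScore a g i X w ^ 2) (μ fun j => (X j).erase i) :=
        integrable_of_measurable_of_abs_le _ ((hsm i X).pow_const 2)
          (B := (4 * √(∑ j, a j ^ 2)) ^ 2) fun w => by
            rw [abs_pow]; exact pow_le_pow_left₀ (abs_nonneg _) (hsb i X w) 2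
      -- `|Z| ≤ Z²/(8M) + 2M`, balanced at `|Z| = 4M`, the root of the second-moment bound `16M²`.
      have h2 : ∫ w, |urnScore a g i X w| ∂(μ fun j => (X j).erase i) ≤
          ∫ w, ((8 * M)⁻¹ * urnScore a g i X w ^ 2 + 2 * M) ∂(μ fun j => (X j).erase i) := by
        refine integral_mono
          (integrable_of_measurable_of_abs_le _ (hsm i X) (hsb i X)).abs
          ((hsq.const_mul _).add (integrable_const _)) fun w => ?_
        have : 0 ≤ (8 * M)⁻¹ * (|urnScore a g i X w| - 4 * M) ^ 2 := by positivity
        have h3 : (8 * M)⁻¹ * (|urnScore a g i X w| - 4 * M) ^ 2 =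
            (8 * M)⁻¹ * urnScore a g i X w ^ 2 + 2 * M - |urnScore a g i X w| := by
          rw [← sq_abs (urnScore a g i X w)]
          field_simp
          ring
        simp only
        linarith
      rw [integral_add (hsq.const_mul _) (integrable_const _), integral_const_mul] at h2
      simp only [integral_const, probReal_univ, one_smul] at h2
      have h3 := mul_le_mul_of_nonneg_left h2 he
      calc _ ≤ _ := h1
        _ ≤ ∫ w, urnScore a g i X w ∂(μ fun j => (X j).erase i) +
            (Real.exp ε - 1) * ((8 * M)⁻¹ *
              ∫ w, urnScore a g i X w ^ 2 ∂(μ fun j => (X j).erase i) + 2 * M) +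
            2 * δ * (4 * √(∑ j, a j ^ 2)) := by linarith
        _ = _ := by rw [div_eq_mul_inv]; ring
    calc _ ≤ ∑ X : K → Finset (Fin m), (urnProd X *
            ∫ w, urnScore a g i X w ∂(μ fun j => (X j).erase i) +
          (Real.exp ε - 1) / (8 * M) * (urnProd X *
            ∫ w, urnScore a g i X w ^ 2 ∂(μ fun j => (X j).erase i)) +
          urnProd X * ((Real.exp ε - 1) * (2 * M) + 8 * δ * √(∑ j, a j ^ 2))) :=
          Finset.sum_le_sum fun X _ => by
            have := mul_le_mul_of_nonneg_left (hX X) (urnProd_pos X).le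
            linarith
      _ = 0 + (Real.exp ε - 1) / (8 * M) * (∑ X : K → Finset (Fin m), urnProd X *
            ∫ w, urnScore a g i X w ^ 2 ∂(μ fun j => (X j).erase i)) +
          ((Real.exp ε - 1) * (2 * M) + 8 * δ * √(∑ j, a j ^ 2)) := by
          rw [Finset.sum_add_distrib, Finset.sum_add_distrib,
            sum_urnProd_mul_integral_urnScore_erase μ g hgm hg a i, ← Finset.mul_sum,
            ← Finset.sum_mul, sum_urnProd, one_mul]
      _ ≤ 0 + (Real.exp ε - 1) / (8 * M) * (16 * M ^ 2) +
          ((Real.exp ε - 1) * (2 * M) + 8 * δ * √(∑ j, a j ^ 2)) := by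
          have := sum_urnProd_mul_integral_urnScore_sq_erase μ g hgm hg a ha i
          have h8 : 0 ≤ (Real.exp ε - 1) / (8 * M) := by positivity
          gcongr
      _ = _ := by field_simp; ring
  calc _ ≤ ∑ _i : Fin m, ((Real.exp ε - 1) * (4 * M) + 8 * δ * √(∑ j, a j ^ 2)) :=
        Finset.sum_le_sum fun i _ => hi i
    _ = _ := by rw [Finset.sum_const, Finset.card_univ, Fintype.card_fin, nsmul_eq_mul]

end

/-! ### Scaled risk and the two-dataset bound -/

/-- The record with coordinates `±L j`, plus where `σ j` is true. -/
noncomputable def signRecord {p : ℕ} (L : EuclideanSpace ℝ (Fin p)) (σ : Fin p → Bool) :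
    signBox L :=
  ⟨WithLp.toLp 2 fun j => if σ j then L j else -L j, fun j => by
    by_cases h : σ j <;> simp [h]⟩

theorem signRecord_apply {p : ℕ} (L : EuclideanSpace ℝ (Fin p)) (σ : Fin p → Bool) (j : Fin p) :
    (signRecord L σ : EuclideanSpace ℝ (Fin p)) j = (if σ j then 1 else -1) * L j := by
  by_cases h : σ j <;> simp [signRecord, h]

/-- The excess risk divided by `β / (2 n)`, as a polynomial in `w / β`. -/
noncomputable def scaledRisk {n p : ℕ} {L : EuclideanSpace ℝ (Fin p)} (β : ℝ)
    (D : Fin n → signBox L) (w : EuclideanSpace ℝ (Fin p)) : ℝ :=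
  ‖∑ i, (D i : EuclideanSpace ℝ (Fin p))‖ * (1 + ‖β⁻¹ • w‖ ^ 2) -
    2 * inner ℝ (β⁻¹ • w) (∑ i, (D i : EuclideanSpace ℝ (Fin p)))

theorem measurable_scaledRisk {n p : ℕ} {L : EuclideanSpace ℝ (Fin p)} (β : ℝ)
    (D : Fin n → signBox L) : Measurable (scaledRisk β D) := by
  unfold scaledRisk
  exact Continuous.measurable (by fun_prop)

theorem scaledRisk_nonneg {n p : ℕ} {L : EuclideanSpace ℝ (Fin p)} (β : ℝ)
    (D : Fin n → signBox L) (w : EuclideanSpace ℝ (Fin p)) : 0 ≤ scaledRisk β D w := by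
  have h := real_inner_le_norm (β⁻¹ • w) (∑ i, (D i : EuclideanSpace ℝ (Fin p)))
  unfold scaledRisk
  nlinarith [mul_nonneg (norm_nonneg (∑ i, (D i : EuclideanSpace ℝ (Fin p))))
    (sq_nonneg (‖β⁻¹ • w‖ - 1))]

/-- Two datasets with opposite sums that are two record changes apart cannot both have small
risk. -/
theorem exists_le_lintegral_scaledRisk_of_neg {n p : ℕ} {L : EuclideanSpace ℝ (Fin p)}
    {ε δ : ℝ} (β : ℝ) (hδ : 0 ≤ δ) (hδ' : (1 + Real.exp ε) * δ ≤ 1 / 2)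
    (hε : 0 ≤ ε)
    (A : (Fin n → signBox L) → ProbabilityMeasure (EuclideanSpace ℝ (Fin p)))
    (hA : IsDifferentiallyPrivate ε δ A) (D₁ D₀ D₂ : Fin n → signBox L)
    (h₁ : ∃ i, ∀ j, j ≠ i → D₁ j = D₀ j) (h₂ : ∃ i, ∀ j, j ≠ i → D₀ j = D₂ j)
    (hD : ∑ i, (D₂ i : EuclideanSpace ℝ (Fin p)) = -∑ i, (D₁ i : EuclideanSpace ℝ (Fin p)))
    (hpos : 0 < ‖∑ i, (D₁ i : EuclideanSpace ℝ (Fin p))‖) :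
    ∃ D : Fin n → signBox L,
      ENNReal.ofReal (‖∑ i, (D₁ i : EuclideanSpace ℝ (Fin p))‖ / (4 * Real.exp ε ^ 2)) ≤
        ∫⁻ w, ENNReal.ofReal (scaledRisk β D w) ∂(A D : Measure (EuclideanSpace ℝ (Fin p))) := by
  by_contra! hcon
  set S := ‖∑ i, (D₁ i : EuclideanSpace ℝ (Fin p))‖ with hS
  have hmarkov : ∀ D : Fin n → signBox L,
      (A D : Measure (EuclideanSpace ℝ (Fin p))).real {w | S ≤ scaledRisk β D w} <
        1 / (4 * Real.exp ε ^ 2) := by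
    intro D
    have h := mul_meas_ge_le_lintegral
      (μ := (A D : Measure (EuclideanSpace ℝ (Fin p))))
      (measurable_scaledRisk β D).ennreal_ofReal (ENNReal.ofReal S)
    have hset : {w | ENNReal.ofReal S ≤ ENNReal.ofReal (scaledRisk β D w)} =
        {w | S ≤ scaledRisk β D w} := by
      ext w
      exact ENNReal.ofReal_le_ofReal_iff (scaledRisk_nonneg β D w)
    rw [hset] at h
    have h' := h.trans_lt (hcon D)
    rw [← ofReal_measureReal, ← ENNReal.ofReal_mul hpos.le,
      ENNReal.ofReal_lt_ofReal_iff (by positivity)] at h'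
    rw [div_eq_mul_one_div] at h'
    exact lt_of_mul_lt_mul_left h' hpos.le
  set U := {w | S ≤ scaledRisk β D₁ w}ᶜ with hU
  have hUm : MeasurableSet U :=
    (measurableSet_le measurable_const (measurable_scaledRisk β D₁)).compl
  -- The two scaled risks add up to at least `2S`, so no output is good for both datasets.
  have hsub : U ⊆ {w | S ≤ scaledRisk β D₂ w} := by
    intro w hw
    simp only [hU, Set.mem_compl_iff, Set.mem_ofPred_eq, not_le] at hw ⊢
    have : scaledRisk β D₁ w + scaledRisk β D₂ w = 2 * S * (1 + ‖β⁻¹ • w‖ ^ 2) := by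
      simp only [scaledRisk, hD, norm_neg, inner_neg_right, ← hS]; ring
    nlinarith [mul_nonneg hpos.le (sq_nonneg ‖β⁻¹ • w‖)]
  have hreal : ∀ D D' : Fin n → signBox L, (∃ i, ∀ j, j ≠ i → D j = D' j) →
      (A D : Measure (EuclideanSpace ℝ (Fin p))).real U ≤
        Real.exp ε * (A D' : Measure (EuclideanSpace ℝ (Fin p))).real U + δ := by
    intro D D' hDD
    have h := hA D D' hDD U hUm
    rw [← ofReal_measureReal, ← ofReal_measureReal,
      ← ENNReal.ofReal_mul (Real.exp_pos ε).le, ← ENNReal.ofReal_add (by positivity) hδ,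
      ENNReal.ofReal_le_ofReal_iff (by positivity)] at h
    exact h
  have e1 := hreal D₁ D₀ h₁
  have e2 := hreal D₀ D₂ h₂
  have e3 := (measureReal_mono hsub (μ := (A D₂ : Measure (EuclideanSpace ℝ (Fin p))))).trans
    (hmarkov D₂).le
  have e4 := hmarkov D₁
  have e5 : (A D₁ : Measure (EuclideanSpace ℝ (Fin p))).real U =
      1 - (A D₁ : Measure (EuclideanSpace ℝ (Fin p))).real {w | S ≤ scaledRisk β D₁ w} :=
    probReal_compl_eq_one_sub (measurableSet_le measurable_const (measurable_scaledRisk β D₁))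
  have he : 1 ≤ Real.exp ε := Real.one_le_exp hε
  have e6 : 1 / (4 * Real.exp ε ^ 2) ≤ 1 / 4 := by
    apply one_div_le_one_div_of_le (by norm_num); nlinarith
  have e7 : Real.exp ε * (Real.exp ε * (A D₂ : Measure (EuclideanSpace ℝ (Fin p))).real U + δ)
      -- Two applications of privacy cost `exp(2ε)`, which the threshold `1/(4 exp(2ε))` absorbs.
      ≤ Real.exp ε * (Real.exp ε * (1 / (4 * Real.exp ε ^ 2)) + δ) := by gcongr
  have e8 : Real.exp ε * (Real.exp ε * (1 / (4 * Real.exp ε ^ 2)) + δ) =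
      1 / 4 + Real.exp ε * δ := by field_simp
  have e9 := mul_le_mul_of_nonneg_left e2 (Real.exp_pos ε).le
  linarith

theorem sum_alternating (l : ℕ) :
    ∑ i : Fin l, (if decide (Even i.1) then (1 : ℝ) else -1) = if Even l then 0 else 1 := by
  rw [← Fin.sum_neg_one_pow ℝ l]
  refine Finset.sum_congr rfl fun i _ => ?_
  by_cases h : Even i.1
  · simp [h]
  · simp [h, (Nat.not_even_iff_odd.1 h).neg_one_pow]

theorem sum_signRecord_const {n p : ℕ} (L : EuclideanSpace ℝ (Fin p)) (s : Fin n → Bool) :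
    ∑ i, (signRecord L (fun _ => s i) : EuclideanSpace ℝ (Fin p)) =
      (∑ i, if s i then (1 : ℝ) else -1) • L := by
  ext j
  simp [signRecord_apply, Finset.sum_mul]

theorem sum_sign_update {n : ℕ} (s : Fin n → Bool) (i : Fin n) (b : Bool) :
    ∑ k, (if Function.update s i b k then (1 : ℝ) else -1) =
      ∑ k, (if s k then (1 : ℝ) else -1) - (if s i then 1 else -1) + if b then 1 else -1 := by
  rw [← Finset.add_sum_erase _ _ (Finset.mem_univ i),
    ← Finset.add_sum_erase _ (fun k => if s k then (1 : ℝ) else -1) (Finset.mem_univ i),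
    Function.update_self]
  rw [Finset.sum_congr rfl fun k hk => by
    rw [Function.update_of_ne (Finset.ne_of_mem_erase hk)]]
  ring

/-- Alternating signs sum to `0` or `1` by parity. For even `n`, flipping one minus or one plus
gives sums `2` and `-2`; for odd `n`, flipping one plus turns `1` into `-1`. -/
theorem exists_opposite_signs {n : ℕ} (hn : 0 < n) :
    ∃ s₁ s₀ s₂ : Fin n → Bool, (∃ i, ∀ j, j ≠ i → s₁ j = s₀ j) ∧
      (∃ i, ∀ j, j ≠ i → s₀ j = s₂ j) ∧
      ∑ i, (if s₂ i then (1 : ℝ) else -1) = -∑ i, (if s₁ i then (1 : ℝ) else -1) ∧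
      1 ≤ ∑ i, (if s₁ i then (1 : ℝ) else -1) := by
  set s₀ : Fin n → Bool := fun i => decide (Even i.1) with hs₀
  have h₀ := sum_alternating n
  by_cases he : Even n
  · have h1 : 1 < n := by
      rcases he with ⟨k, rfl⟩; omega
    refine ⟨Function.update s₀ ⟨1, h1⟩ true, s₀, Function.update s₀ ⟨0, hn⟩ false,
      ⟨⟨1, h1⟩, fun j hj => Function.update_of_ne hj _ _⟩,
      ⟨⟨0, hn⟩, fun j hj => (Function.update_of_ne hj _ _).symm⟩, ?_, ?_⟩ <;>
    simp only [sum_sign_update, hs₀, h₀, he] <;> norm_num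
  · refine ⟨s₀, s₀, Function.update s₀ ⟨0, hn⟩ false,
      ⟨⟨0, hn⟩, fun j _ => rfl⟩,
      ⟨⟨0, hn⟩, fun j hj => (Function.update_of_ne hj _ _).symm⟩, ?_, ?_⟩ <;>
    simp only [sum_sign_update, hs₀, h₀, he] <;> norm_num

theorem exists_norm_le_lintegral_scaledRisk {n p : ℕ} (hn : 0 < n)
    {L : EuclideanSpace ℝ (Fin p)} (hL : L ≠ 0)
    {ε δ : ℝ} (β : ℝ) (hδ : 0 ≤ δ) (hδ' : (1 + Real.exp ε) * δ ≤ 1 / 2) (hε : 0 ≤ ε)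
    (A : (Fin n → signBox L) → ProbabilityMeasure (EuclideanSpace ℝ (Fin p)))
    (hA : IsDifferentiallyPrivate ε δ A) :
    ∃ D : Fin n → signBox L, ENNReal.ofReal (‖L‖ / (4 * Real.exp ε ^ 2)) ≤
        ∫⁻ w, ENNReal.ofReal (scaledRisk β D w) ∂(A D : Measure (EuclideanSpace ℝ (Fin p))) := by
  obtain ⟨s₁, s₀, s₂, ⟨i, hi⟩, ⟨k, hk⟩, hneg, hone⟩ := exists_opposite_signs hn
  have hnorm : ‖L‖ ≤ ‖∑ i, (signRecord L (fun _ => s₁ i) : EuclideanSpace ℝ (Fin p))‖ := by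
    rw [sum_signRecord_const, norm_smul, Real.norm_of_nonneg (by linarith)]
    nlinarith [norm_nonneg L]
  obtain ⟨D, hD⟩ := exists_le_lintegral_scaledRisk_of_neg β hδ hδ' hε A hA
    (fun i => signRecord L fun _ => s₁ i) (fun i => signRecord L fun _ => s₀ i)
    (fun i => signRecord L fun _ => s₂ i)
    ⟨i, fun j hj => by rw [hi j hj]⟩ ⟨k, fun j hj => by rw [hk j hj]⟩
    (by rw [sum_signRecord_const, sum_signRecord_const, hneg, neg_smul])
    ((norm_pos_iff.2 hL).trans_le hnorm)
  exact ⟨D, (ENNReal.ofReal_le_ofReal (by gcongr)).trans hD⟩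

/-! ### Hard datasets from the urn -/

/-- The dataset whose first `m` records carry the signs `X` on the coordinates in `J`; all other
signs alternate along the records. -/
noncomputable def urnData {p m : ℕ} (l : ℕ) (L : EuclideanSpace ℝ (Fin p)) (J : Finset (Fin p))
    (X : Fin p → Finset (Fin m)) : Fin (m + l) → signBox L :=
  Fin.append
    (fun i => signRecord L fun j => if j ∈ J then decide (i ∈ X j) else decide (Even i.1))
    (fun i => signRecord L fun _ => decide (Even i.1))

theorem urnData_eq_of_erase_eq {p m : ℕ} (l : ℕ) (L : EuclideanSpace ℝ (Fin p))
    (J : Finset (Fin p)) (i : Fin m) (X Y : Fin p → Finset (Fin m))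
    (h : ∀ j, (X j).erase i = (Y j).erase i) (k : Fin (m + l)) (hk : k ≠ Fin.castAdd l i) :
    urnData l L J X k = urnData l L J Y k := by
  induction k using Fin.addCases with
  | left k =>
    have hki : k ≠ i := fun h => hk (by rw [h])
    have : ∀ j, (k ∈ X j ↔ k ∈ Y j) := fun j => by
      have := congrArg (k ∈ ·) (h j)
      simpa [hki] using this
    simp [urnData, this]
  | right k => simp [urnData]

/-- The random part of the sum of `urnData`. -/
noncomputable def urnSum {p m : ℕ} (L : EuclideanSpace ℝ (Fin p)) (J : Finset (Fin p))
    (X : Fin p → Finset (Fin m)) : EuclideanSpace ℝ (Fin p) :=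
  WithLp.toLp 2 fun j => (if j ∈ J then L j else 0) * signSum (X j)

theorem norm_sum_urnData_sub_urnSum_le {p m : ℕ} (l : ℕ) (L : EuclideanSpace ℝ (Fin p))
    (J : Finset (Fin p)) (X : Fin p → Finset (Fin m)) :
    ‖∑ i, (urnData l L J X i : EuclideanSpace ℝ (Fin p)) - urnSum L J X‖ ≤ 2 * ‖L‖ := by
  have h : ∀ j, |(∑ i, (urnData l L J X i : EuclideanSpace ℝ (Fin p)) - urnSum L J X) j| ≤
      2 * |L j| := by
    intro j
    have h1 : (∑ i, (urnData l L J X i : EuclideanSpace ℝ (Fin p)) - urnSum L J X) j =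
        ((if j ∈ J then 0 else if Even m then 0 else 1) + if Even l then 0 else 1) * L j := by
      rw [PiLp.sub_apply, Fin.sum_univ_add]
      simp only [urnData, Fin.append_left, Fin.append_right, PiLp.add_apply, WithLp.ofLp_sum,
        Finset.sum_apply, signRecord_apply, ← Finset.sum_mul, sum_alternating, urnSum]
      by_cases hj : j ∈ J
      · simp only [hj, if_true, decide_eq_true_eq]
        have : ∑ i : Fin m, (if i ∈ X j then (1 : ℝ) else -1) = signSum (X j) :=
          sum_recordSign (X j)
        rw [this]; ring
      · simp only [hj, if_false, sum_alternating]; ring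
    rw [h1, abs_mul]
    gcongr
    split_ifs <;> norm_num
  rw [EuclideanSpace.norm_eq, EuclideanSpace.norm_eq, ← Real.sqrt_sq (zero_le_two : (0 : ℝ) ≤ 2),
    ← Real.sqrt_mul (by norm_num), Finset.mul_sum]
  refine Real.sqrt_le_sqrt (Finset.sum_le_sum fun j _ => ?_)
  rw [← mul_pow]
  exact pow_le_pow_left₀ (norm_nonneg _) (h j) 2

/-- The rescaled output, replaced by `0` when its norm exceeds `2`. -/
noncomputable def clippedOutput {p : ℕ} (β : ℝ) (w : EuclideanSpace ℝ (Fin p)) :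
    EuclideanSpace ℝ (Fin p) := if ‖β⁻¹ • w‖ ≤ 2 then β⁻¹ • w else 0

theorem norm_clippedOutput_le {p : ℕ} (β : ℝ) (w : EuclideanSpace ℝ (Fin p)) :
    ‖clippedOutput β w‖ ≤ 2 := by
  unfold clippedOutput
  split_ifs with h
  · exact h
  · simp

theorem measurable_clippedOutput {p : ℕ} (β : ℝ) :
    Measurable (clippedOutput β : EuclideanSpace ℝ (Fin p) → _) := by
  unfold clippedOutput
  exact Measurable.ite (measurableSet_le (by fun_prop) measurable_const) (by fun_prop)
    measurable_const

/-- Clipping is harmless: for `‖u‖ > 2` the scaled risk is at least `‖s‖(‖u‖ - 1)² ≥ ‖s‖`, the value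
of the left side at output `0`. -/
theorem norm_sub_inner_clippedOutput_le {n p : ℕ} {L : EuclideanSpace ℝ (Fin p)} (β : ℝ)
    (D : Fin n → signBox L) (w : EuclideanSpace ℝ (Fin p)) :
    ‖∑ i, (D i : EuclideanSpace ℝ (Fin p))‖ -
      2 * inner ℝ (clippedOutput β w) (∑ i, (D i : EuclideanSpace ℝ (Fin p))) ≤
      scaledRisk β D w := by
  unfold clippedOutput scaledRisk
  have h0 := norm_nonneg (∑ i, (D i : EuclideanSpace ℝ (Fin p)))
  split_ifs with h
  · nlinarith [mul_nonneg h0 (sq_nonneg ‖β⁻¹ • w‖)]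
  · push Not at h
    have h1 := real_inner_le_norm (β⁻¹ • w) (∑ i, (D i : EuclideanSpace ℝ (Fin p)))
    simp only [inner_zero_left]
    nlinarith [mul_nonneg h0 (mul_nonneg (norm_nonneg (β⁻¹ • w)) (sub_nonneg.2 h.le))]

theorem integral_le_of_lintegral_ofReal_le {Ω : Type*} [MeasurableSpace Ω] {μ : Measure Ω}
    {f Q : Ω → ℝ} (hf : Integrable f μ) (hfQ : ∀ w, f w ≤ Q w) {r : ℝ} (hr : 0 ≤ r)
    (h : ∫⁻ w, ENNReal.ofReal (Q w) ∂μ ≤ ENNReal.ofReal r) : ∫ w, f w ∂μ ≤ r := by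
  have h1 : ∫ w, f w ∂μ ≤ ∫ w, max (f w) 0 ∂μ :=
    integral_mono hf hf.pos_part fun w => le_max_left _ _
  refine h1.trans ?_
  rw [← ENNReal.ofReal_le_ofReal_iff hr, ofReal_integral_eq_lintegral_ofReal hf.pos_part
    (.of_forall fun w => le_max_right _ _)]
  refine (lintegral_mono fun w => ?_).trans h
  rw [ENNReal.ofReal_max]
  simpa using ENNReal.ofReal_le_ofReal (hfQ w)

theorem exists_le_lintegral_scaledRisk_urnData {p m : ℕ} (l : ℕ) (hm : 0 < m)
    {L : EuclideanSpace ℝ (Fin p)} (hL : ∀ j, 0 < L j) (J : Finset (Fin p))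
    {M : ℝ} (hM : 0 < M) (hJM : ∀ j ∈ J, L j ≤ M)
    {ε δ : ℝ} (β : ℝ) (hε : 0 ≤ ε) (hδ : 0 ≤ δ)
    (A : (Fin (m + l) → signBox L) → ProbabilityMeasure (EuclideanSpace ℝ (Fin p)))
    (hA : IsDifferentiallyPrivate ε δ A)
    (h₁ : 120 * ‖L‖ ≤ m * √(∑ j ∈ J, L j ^ 2))
    (h₂ : 96 * m * M * (Real.exp ε - 1) < √(∑ j ∈ J, L j ^ 2))
    (h₃ : 192 * m * δ ≤ 1) :
    ∃ D : Fin (m + l) → signBox L,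
      ENNReal.ofReal (m * √(∑ j ∈ J, L j ^ 2) / 12) ≤
        ∫⁻ w, ENNReal.ofReal (scaledRisk β D w) ∂(A D : Measure (EuclideanSpace ℝ (Fin p))) := by
  by_contra! hcon
  set N := √(∑ j ∈ J, L j ^ 2) with hN
  have hm' : (1 : ℝ) ≤ m := by exact_mod_cast hm
  have hN0 : 0 ≤ N := Real.sqrt_nonneg _
  have hNpos : 0 < N := lt_of_le_of_lt
    (mul_nonneg (by positivity) (by linarith [Real.one_le_exp hε])) h₂
  set a : Fin p → ℝ := fun j => if j ∈ J then L j else 0 with ha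
  have ha2 : ∑ j, a j ^ 2 = ∑ j ∈ J, L j ^ 2 := by
    simp [ha, ite_pow]
  have haM : ∀ j, |a j| ≤ M := fun j => by
    by_cases hj : j ∈ J
    · simpa [ha, hj, abs_of_pos (hL j)] using hJM j hj
    · simpa [ha, hj] using hM.le
  set g : Fin p → EuclideanSpace ℝ (Fin p) → ℝ := fun j w => clippedOutput β w j with hg
  have hgm : ∀ j, Measurable (g j) := fun j =>
    (EuclideanSpace.proj (𝕜 := ℝ) j).continuous.measurable.comp (measurable_clippedOutput β)
  have hg4 : ∀ w, ∑ j, g j w ^ 2 ≤ 4 := fun w => by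
    have h := norm_clippedOutput_le β w
    have h' := EuclideanSpace.real_norm_sq_eq (clippedOutput β w)
    simp only [hg]
    rw [← h']
    nlinarith [norm_nonneg (clippedOutput β w)]
  have hgi : ∀ (j : Fin p) (ν : Measure (EuclideanSpace ℝ (Fin p))) [IsProbabilityMeasure ν],
      Integrable (g j) ν :=
    fun j ν _ => integrable_of_measurable_of_abs_le ν (hgm j) (abs_le_two_of_sum_sq_le g hg4 j)
  have hfp := fingerprinting (m := m) hε hδ
    (fun X => (A (urnData l L J X) : Measure (EuclideanSpace ℝ (Fin p))))
    (fun i X Y hXY => hA _ _ ⟨Fin.castAdd l i, urnData_eq_of_erase_eq l L J i X Y hXY⟩)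
    g hgm hg4 a hM haM
  rw [ha2, ← hN] at hfp
  -- Replacing `s` by its random part costs `2‖L‖` in the norm and `2 · 2 · 2‖L‖` in the inner
  -- product, hence `10‖L‖`.
  have hX : ∀ X : Fin p → Finset (Fin m),
      ‖urnSum L J X‖ - 10 * ‖L‖ - m * N / 12 ≤
        2 * ∑ j, a j * signSum (X j) *
          ∫ w, g j w ∂(A (urnData l L J X) : Measure (EuclideanSpace ℝ (Fin p))) := by
    intro X
    set s := ∑ i, (urnData l L J X i : EuclideanSpace ℝ (Fin p)) with hs
    have hb := norm_sum_urnData_sub_urnSum_le l L J X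
    rw [← hs] at hb
    have hpt : ∀ w, (‖urnSum L J X‖ - 10 * ‖L‖) - 2 * ∑ j, a j * signSum (X j) * g j w ≤
        scaledRisk β (urnData l L J X) w := by
      intro w
      have h1 := norm_sub_inner_clippedOutput_le β (urnData l L J X) w
      rw [← hs] at h1
      have h2 : inner ℝ (clippedOutput β w) s = ∑ j, a j * signSum (X j) * g j w +
          inner ℝ (clippedOutput β w) (s - urnSum L J X) := by
        rw [inner_sub_right]
        have : inner ℝ (clippedOutput β w) (urnSum L J X) =
            ∑ j, a j * signSum (X j) * g j w := by
          simp [PiLp.inner_apply, urnSum, ha, hg]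
        rw [this]; ring
      have h3 : inner ℝ (clippedOutput β w) (s - urnSum L J X) ≤ 2 * (2 * ‖L‖) :=
        (real_inner_le_norm _ _).trans (mul_le_mul (norm_clippedOutput_le β w) hb
          (norm_nonneg _) (by norm_num))
      have h4 : ‖urnSum L J X‖ ≤ ‖s‖ + ‖s - urnSum L J X‖ := by
        rw [norm_sub_rev, add_comm]
        exact norm_le_norm_sub_add _ _
      linarith
    have hint : Integrable (fun w => ∑ j, a j * signSum (X j) * g j w)
        (A (urnData l L J X) : Measure (EuclideanSpace ℝ (Fin p))) :=
      integrable_finsetSum _ fun j _ => (hgi j _).const_mul _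
    have h5 := integral_le_of_lintegral_ofReal_le
      ((integrable_const (‖urnSum L J X‖ - 10 * ‖L‖)).sub (hint.const_mul 2)) hpt
      (by positivity) (hcon (urnData l L J X)).le
    simp only [Pi.sub_apply] at h5
    rw [integral_sub (integrable_const _) (hint.const_mul 2), integral_const_mul,
      integral_finsetSum _ fun j _ => (hgi j _).const_mul _] at h5
    simp only [integral_const, probReal_univ, one_smul, integral_const_mul] at h5
    linarith
  have hnorm : N * (m / 3) ≤ ∑ X : Fin p → Finset (Fin m), urnProd X * ‖urnSum L J X‖ := by
    -- Cauchy–Schwarz against `a` bounds the norm below by a form linear in `|S|`, whose mean is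
    -- known coordinatewise.
    have h1 : ∀ X : Fin p → Finset (Fin m), ∑ j, a j ^ 2 * |signSum (X j)| ≤
        N * ‖urnSum L J X‖ := by
      intro X
      have := Real.sum_mul_le_sqrt_mul_sqrt Finset.univ a (fun j => a j * |signSum (X j)|)
      rw [ha2, ← hN] at this
      rw [EuclideanSpace.norm_eq]
      convert this using 2
      · ring
      · congr 1
        refine Finset.sum_congr rfl fun j _ => ?_
        simp only [urnSum, Real.norm_eq_abs, sq_abs, mul_pow, ha]
    have h2 : ∑ j, a j ^ 2 * ((m : ℝ) / 3) ≤
        ∑ X : Fin p → Finset (Fin m), urnProd X * (N * ‖urnSum L J X‖) := by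
      calc _ ≤ ∑ j, a j ^ 2 * ∑ X : Fin p → Finset (Fin m), urnProd X * |signSum (X j)| := by
            refine Finset.sum_le_sum fun j _ => mul_le_mul_of_nonneg_left ?_ (sq_nonneg _)
            rw [sum_urnProd_mul j fun x => |signSum x|]
            exact sum_urnWeight_mul_abs_signSum m
        _ = ∑ X : Fin p → Finset (Fin m), urnProd X * ∑ j, a j ^ 2 * |signSum (X j)| := by
            simp only [Finset.mul_sum]
            rw [Finset.sum_comm]
            exact Finset.sum_congr rfl fun X _ => Finset.sum_congr rfl fun j _ => by ring
        _ ≤ _ := Finset.sum_le_sum fun X _ =>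
            mul_le_mul_of_nonneg_left (h1 X) (urnProd_pos X).le
    have h3 : ∑ X : Fin p → Finset (Fin m), urnProd X * (N * ‖urnSum L J X‖) =
        N * ∑ X : Fin p → Finset (Fin m), urnProd X * ‖urnSum L J X‖ := by
      rw [Finset.mul_sum]; exact Finset.sum_congr rfl fun X _ => by ring
    have h4 : ∑ j, a j ^ 2 = N * N := by
      rw [ha2, hN, Real.mul_self_sqrt (Finset.sum_nonneg fun j _ => sq_nonneg _)]
    rw [← Finset.sum_mul, h3, h4, mul_assoc] at h2
    exact le_of_mul_le_mul_left h2 hNpos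
  have hsum : N * (m / 3) - (10 * ‖L‖ + m * N / 12) ≤
      2 * ∑ X : Fin p → Finset (Fin m), urnProd X * ∑ j, a j * signSum (X j) *
        ∫ w, g j w ∂(A (urnData l L J X) : Measure (EuclideanSpace ℝ (Fin p))) := by
    have h1 : ∑ X : Fin p → Finset (Fin m),
        urnProd X * (‖urnSum L J X‖ - (10 * ‖L‖ + m * N / 12)) ≤
        ∑ X : Fin p → Finset (Fin m), urnProd X * (2 * ∑ j, a j * signSum (X j) *
          ∫ w, g j w ∂(A (urnData l L J X) : Measure (EuclideanSpace ℝ (Fin p)))) :=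
      Finset.sum_le_sum fun X _ => mul_le_mul_of_nonneg_left (by linarith [hX X]) (urnProd_pos X).le
    simp only [mul_sub, Finset.sum_sub_distrib] at h1
    rw [← Finset.sum_mul, sum_urnProd, one_mul] at h1
    have h2 : ∑ X : Fin p → Finset (Fin m), urnProd X * (2 * ∑ j, a j * signSum (X j) *
          ∫ w, g j w ∂(A (urnData l L J X) : Measure (EuclideanSpace ℝ (Fin p)))) =
        2 * ∑ X : Fin p → Finset (Fin m), urnProd X * ∑ j, a j * signSum (X j) *
          ∫ w, g j w ∂(A (urnData l L J X) : Measure (EuclideanSpace ℝ (Fin p))) := by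
      rw [Finset.mul_sum]; exact Finset.sum_congr rfl fun X _ => by ring
    linarith
  set E := ∑ X : Fin p → Finset (Fin m), urnProd X * ∑ j, a j * signSum (X j) *
        ∫ w, g j w ∂(A (urnData l L J X) : Measure (EuclideanSpace ℝ (Fin p))) with hE
  -- `10‖L‖ ≤ mN/12` by `h₁`, so `2E ≥ mN(1/3 - 1/12 - 1/12)`.
  have hE1 : m * N / 12 ≤ E := by nlinarith
  have hE2 : N / 12 ≤ 2 / (m + 1) * E := by
    refine le_trans ?_ (mul_le_mul_of_nonneg_left hE1 (by positivity))
    rw [div_mul_eq_mul_div, le_div_iff₀ (by positivity)]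
    nlinarith
  -- In `hfp` the `ε` term is below `N/24` by `h₂` and the `δ` term at most `N/24` by `h₃`, against
  -- `hE2`.
  nlinarith

/-! ### Choice of the number of urn records -/

/-- Main lower bound: a set `J` of coordinates of comparable scale forces a large scaled risk. -/
theorem exists_forall_le_lintegral_scaledRisk {ε₀ R : ℝ} (hε₀ : 0 < ε₀) (hR : 1 ≤ R) :
    ∃ c : ℝ, 0 < c ∧ ∀ (n p : ℕ), 0 < n →
      ∀ L : EuclideanSpace ℝ (Fin p), (∀ j, 0 < L j) →
      ∀ (J : Finset (Fin p)) (lam : ℝ), J.Nonempty → 0 < lam →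
      (∀ j ∈ J, lam ≤ L j ∧ L j ≤ R * lam) →
      ∀ ε δ β : ℝ, 0 < ε → ε ≤ ε₀ → 0 ≤ δ → δ ≤ 1 / (192 * Real.exp ε₀) / n →
      ∀ A : (Fin n → signBox L) → ProbabilityMeasure (EuclideanSpace ℝ (Fin p)),
        IsDifferentiallyPrivate ε δ A →
        ∃ D : Fin n → signBox L,
          ENNReal.ofReal (c * (lam * √(J.card : ℝ) * min (n : ℝ) (√(J.card : ℝ) / ε))) ≤
            ∫⁻ w, ENNReal.ofReal (scaledRisk β D w)
              ∂(A D : Measure (EuclideanSpace ℝ (Fin p))) := by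
  set e := Real.exp ε₀ with he
  have he1 : 1 ≤ e := Real.one_le_exp hε₀.le
  set C := 100 * R * e with hC
  have hC1 : 100 ≤ C := by rw [hC]; nlinarith
  refine ⟨1 / (960 * C * e ^ 2), by positivity, ?_⟩
  intro n p hn L hL J lam hJ hlam hJL ε δ β hε hεε hδ hδn A hA
  have hexp : Real.exp ε ≤ e := Real.exp_le_exp.2 hεε
  have hn1 : (1 : ℝ) ≤ n := by exact_mod_cast hn
  have hnδ : 192 * n * δ * e ≤ 1 := by
    rw [div_div, le_div_iff₀ (by positivity)] at hδn
    linarith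
  set q := √(J.card : ℝ) with hq
  have hq0 : 0 < q := Real.sqrt_pos.2 (by exact_mod_cast hJ.card_pos)
  set T := lam * q * min (n : ℝ) (q / ε) with hT
  have hmin : 0 < min (n : ℝ) (q / ε) := lt_min (by linarith) (by positivity)
  have hNq : lam * q ≤ √(∑ j ∈ J, L j ^ 2) := by
    apply Real.le_sqrt_of_sq_le
    rw [mul_pow, hq, Real.sq_sqrt (Nat.cast_nonneg _), mul_comm, ← nsmul_eq_mul]
    exact Finset.card_nsmul_le_sum _ _ _ fun j hj =>
      pow_le_pow_left₀ hlam.le (hJL j hj).1 2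
  have hNL : √(∑ j ∈ J, L j ^ 2) ≤ ‖L‖ := by
    rw [EuclideanSpace.norm_eq]
    refine Real.sqrt_le_sqrt ?_
    simp only [Real.norm_eq_abs, sq_abs]
    exact Finset.sum_le_univ_sum_of_nonneg fun j => sq_nonneg _
  have hLpos : 0 < ‖L‖ := (by positivity : 0 < lam * q).trans_le (hNq.trans hNL)
  -- Below this threshold the two-dataset bound suffices; above it, `T / (2C) ≥ 120‖L‖`, which makes
  -- the alternating signs negligible.
  by_cases hcase : T ≤ 240 * C * ‖L‖
  · have hδ2 : (1 + Real.exp ε) * δ ≤ 1 / 2 := by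
      have h1 : δ * e ≤ n * (δ * e) := le_mul_of_one_le_left (by positivity) hn1
      have h2 : (1 + Real.exp ε) * δ ≤ (e + e) * δ := by gcongr
      linarith
    obtain ⟨D, hD⟩ := exists_norm_le_lintegral_scaledRisk hn (norm_pos_iff.1 hLpos) β hδ hδ2 hε.le
      A hA
    refine ⟨D, (ENNReal.ofReal_le_ofReal ?_).trans hD⟩
    calc 1 / (960 * C * e ^ 2) * T ≤ 1 / (960 * C * e ^ 2) * (240 * C * ‖L‖) := by gcongr
      _ = ‖L‖ / (4 * e ^ 2) := by field_simp; norm_num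
      _ ≤ ‖L‖ / (4 * Real.exp ε ^ 2) := by gcongr
  · push Not at hcase
    have hbig : 240 * C < min (n : ℝ) (q / ε) := by
      have h1 : T ≤ ‖L‖ * min (n : ℝ) (q / ε) :=
        mul_le_mul_of_nonneg_right (hNq.trans hNL) hmin.le
      have h2 := hcase.trans_le h1
      rw [mul_comm ‖L‖] at h2
      exact lt_of_mul_lt_mul_right h2 hLpos.le
    -- The largest order of `m` for which the fingerprinting bound stays below `N`; the remaining `l
    -- = n - m` records are padding.
    set m := min n ⌊q / ε / C⌋₊ with hm
    have hfloor : (⌊q / ε / C⌋₊ : ℝ) ≤ q / ε / C := Nat.floor_le (by positivity)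
    have hy : 240 ≤ q / ε / C := by
      rw [le_div_iff₀ (by positivity)]
      linarith [min_le_right (n : ℝ) (q / ε)]
    have hmle : (m : ℝ) ≤ q / ε / C := le_trans (by exact_mod_cast min_le_right _ _) hfloor
    have hmge : min (n : ℝ) (q / ε) / (2 * C) ≤ m := by
      rw [hm, Nat.cast_min]
      refine le_min ?_ ?_
      · refine (div_le_self hmin.le (by linarith)).trans (min_le_left _ _)
      · have h1 := Nat.lt_floor_add_one (q / ε / C)
        have h2 : min (n : ℝ) (q / ε) / (2 * C) ≤ q / ε / C / 2 := by
          rw [div_div (q / ε), mul_comm C 2]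
          gcongr
          exact min_le_right _ _
        linarith
    have hmpos : 0 < m := by
      have : (0 : ℝ) < m := lt_of_lt_of_le (by positivity) hmge
      exact_mod_cast this
    obtain ⟨l, hl⟩ := Nat.exists_eq_add_of_le (min_le_left n ⌊q / ε / C⌋₊)
    rw [← hm] at hl
    have hmn : (m : ℝ) ≤ n := by exact_mod_cast min_le_left _ _
    clear_value m
    clear hm
    have hTm : T / (2 * C) ≤ m * √(∑ j ∈ J, L j ^ 2) := by
      calc T / (2 * C) = min (n : ℝ) (q / ε) / (2 * C) * (lam * q) := by rw [hT]; ring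
        _ ≤ _ := by gcongr
    have h₁ : 120 * ‖L‖ ≤ m * √(∑ j ∈ J, L j ^ 2) := by
      refine le_trans ?_ hTm
      rw [le_div_iff₀ (by positivity)]
      linarith
    have h₂ : 96 * m * (R * lam) * (Real.exp ε - 1) < √(∑ j ∈ J, L j ^ 2) := by
      refine lt_of_lt_of_le ?_ hNq
      have h3 : Real.exp ε - 1 ≤ ε * e := by
        have h4 := Real.add_one_le_exp (-ε)
        have h5 : Real.exp ε * Real.exp (-ε) = 1 := by rw [← Real.exp_add]; simp
        have h6 := mul_le_mul_of_nonneg_left h4 (Real.exp_pos ε).le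
        have h7 : Real.exp ε * ε ≤ e * ε := by gcongr
        linarith
      have h8 : 0 ≤ Real.exp ε - 1 := by linarith [Real.one_le_exp hε.le]
      calc 96 * m * (R * lam) * (Real.exp ε - 1)
          ≤ 96 * (q / ε / C) * (R * lam) * (ε * e) := by gcongr
        _ = 96 / 100 * (lam * q) := by rw [hC]; field_simp
        _ < lam * q := by linarith [mul_pos hlam hq0]
    have h₃ : 192 * m * δ ≤ 1 := by
      calc 192 * m * δ ≤ 192 * n * δ := by gcongr
        _ ≤ 192 * n * δ * e := le_mul_of_one_le_right (by positivity) he1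
        _ ≤ 1 := hnδ
    subst hl
    obtain ⟨D, hD⟩ := exists_le_lintegral_scaledRisk_urnData l hmpos hL J (by positivity)
      (fun j hj => (hJL j hj).2) β hε.le hδ A hA h₁ h₂ h₃
    refine ⟨D, (ENNReal.ofReal_le_ofReal ?_).trans hD⟩
    calc 1 / (960 * C * e ^ 2) * T ≤ 1 / (24 * C) * T := by
          have hT0 : 0 ≤ T := by positivity
          refine mul_le_mul_of_nonneg_right (one_div_le_one_div_of_le (by positivity) ?_) hT0
          nlinarith [one_le_pow₀ (n := 2) he1]
      _ = T / (2 * C) / 12 := by field_simp; ring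
      _ ≤ _ := by gcongr

/-! ### From scaled risk to hard instances -/

theorem compositeObjective_linearLoss {n p : ℕ} {L : EuclideanSpace ℝ (Fin p)}
    (β : ℝ) (D : Fin n → signBox L) (w : EuclideanSpace ℝ (Fin p)) :
    compositeObjective (linearLoss L) (ridgeRegularizer β D) D w =
      -(1 / n) * inner ℝ w (∑ i, (D i : EuclideanSpace ℝ (Fin p))) +
        ‖∑ i, (D i : EuclideanSpace ℝ (Fin p))‖ / (2 * β * n) * ‖w‖ ^ 2 := by
  simp only [compositeObjective, linearLoss, ridgeRegularizer, inner_sum, Finset.sum_neg_distrib]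
  ring

theorem isCompositeERM_linearLoss_ridge {n p : ℕ} {L : EuclideanSpace ℝ (Fin p)}
    (hL : ∀ j, 0 < L j) {β : ℝ} (hβ : 0 < β) (D : Fin n → signBox L) :
    IsCompositeERM L (linearLoss L) (ridgeRegularizer β D) where
  loss_convex d := by
    have : (fun w => linearLoss L w d) =
        (innerSL ℝ (-(d : EuclideanSpace ℝ (Fin p)))).toLinearMap := by
      funext w
      simp [linearLoss, real_inner_comm]
    rw [this]
    exact LinearMap.convexOn _ convex_univ
  loss_smooth := by
    -- The loss is linear, so any positive smoothness vector would do.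
    refine ⟨L, hL, fun d => ?_⟩
    have hg : ∀ v : EuclideanSpace ℝ (Fin p), HasGradientAt (fun w => linearLoss L w d)
        (-(d : EuclideanSpace ℝ (Fin p))) v := fun v => by
      rw [hasGradientAt_iff_hasFDerivAt]
      have h := (innerSL ℝ (-(d : EuclideanSpace ℝ (Fin p)))).hasFDerivAt (x := v)
      have h2 : (fun w => linearLoss L w d) = innerSL ℝ (-(d : EuclideanSpace ℝ (Fin p))) := by
        funext w
        simp [linearLoss, real_inner_comm]
      rw [h2]
      exact h
    refine ⟨fun v => (hg v).differentiableAt, fun v w => ?_⟩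
    rw [(hg v).gradient]
    have h1 : 0 ≤ ∑ j, L j * (w j - v j) ^ 2 :=
      Finset.sum_nonneg fun j _ => mul_nonneg (hL j).le (sq_nonneg _)
    have h2 : linearLoss L w d = linearLoss L v d +
        inner ℝ (-(d : EuclideanSpace ℝ (Fin p))) (w - v) := by
      simp only [linearLoss, inner_sub_right, inner_neg_left,
        real_inner_comm (d : EuclideanSpace ℝ (Fin p))]
      ring
    linarith
  loss_lipschitz d w t j := by
    have : linearLoss L (w + t • EuclideanSpace.single j (1 : ℝ)) d - linearLoss L w d =
        -(t * (d : EuclideanSpace ℝ (Fin p)) j) := by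
      simp [linearLoss, inner_add_left, inner_smul_left, EuclideanSpace.inner_single_left]
    rw [this, abs_neg, abs_mul, mul_comm]
    have : |(d : EuclideanSpace ℝ (Fin p)) j| = L j := by
      rcases d.2 j with h | h <;> simp [h, abs_of_pos (hL j)]
    rw [this]
  reg_convex := by
    have h : ConvexOn ℝ Set.univ fun w : EuclideanSpace ℝ (Fin p) => ‖w‖ ^ 2 :=
      convexOn_univ_norm.pow (fun _ _ => norm_nonneg _) 2
    exact h.smul (by positivity)
  reg_separable := by
    refine ⟨fun _ x => ‖∑ i, (D i : EuclideanSpace ℝ (Fin p))‖ / (2 * β * n) * x ^ 2, fun w => ?_⟩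
    rw [ridgeRegularizer, EuclideanSpace.real_norm_sq_eq, Finset.mul_sum]

theorem isHardInstance_of_le_lintegral_scaledRisk {n p : ℕ} (hn : 0 < n)
    {L : EuclideanSpace ℝ (Fin p)} (hL : ∀ j, 0 < L j) {β : ℝ} (hβ : 0 < β)
    (A : (Fin n → signBox L) → ProbabilityMeasure (EuclideanSpace ℝ (Fin p)))
    (D : Fin n → signBox L) {r : ℝ} (hr : 0 < r)
    (h : ENNReal.ofReal (2 * n / β * r) ≤ ∫⁻ w, ENNReal.ofReal (scaledRisk β D w)
      ∂(A D : Measure (EuclideanSpace ℝ (Fin p)))) :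
    IsHardInstance L β A D r := by
  have hn' : (0 : ℝ) < n := by exact_mod_cast hn
  set s := ∑ i, (D i : EuclideanSpace ℝ (Fin p)) with hs
  -- The scaled risk vanishes identically when `s = 0`, so a positive lower bound excludes this
  -- case.
  have hs0 : s ≠ 0 := by
    intro h0
    have : ∀ w, scaledRisk β D w = 0 := fun w => by simp [scaledRisk, ← hs, h0]
    simp only [this, ENNReal.ofReal_zero, lintegral_zero, nonpos_iff_eq_zero,
      ENNReal.ofReal_eq_zero] at h
    exact absurd h (not_le.2 (by positivity))
  have hspos : 0 < ‖s‖ := norm_pos_iff.2 hs0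
  set wstar : EuclideanSpace ℝ (Fin p) := (β / ‖s‖) • s with hw
  have hdiff : ∀ w, compositeObjective (linearLoss L) (ridgeRegularizer β D) D w -
      compositeObjective (linearLoss L) (ridgeRegularizer β D) D wstar =
      β / (2 * n) * scaledRisk β D w := by
    intro w
    simp only [compositeObjective_linearLoss, scaledRisk, ← hs, hw, norm_smul, inner_smul_left,
      real_inner_self_eq_norm_sq, Real.norm_eq_abs, abs_of_pos (div_pos hβ hspos),
      abs_of_pos (inv_pos.2 hβ), RCLike.conj_to_real]
    field_simp
    ring
  refine ⟨hs0, isCompositeERM_linearLoss_ridge hL hβ D, wstar, ?_, ?_, ?_⟩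
  · intro w _
    have h1 := hdiff w
    have h2 := scaledRisk_nonneg β D w
    have : 0 ≤ β / (2 * n) * scaledRisk β D w := by positivity
    exact sub_nonneg.1 (h1 ▸ this)
  · rw [hw, norm_smul, Real.norm_of_nonneg (by positivity)]
    field_simp
  · simp only [hdiff]
    have h1 : ∀ w, ENNReal.ofReal (β / (2 * n) * scaledRisk β D w) =
        ENNReal.ofReal (β / (2 * n)) * ENNReal.ofReal (scaledRisk β D w) := fun w =>
      ENNReal.ofReal_mul (by positivity)
    simp only [h1]
    rw [lintegral_const_mul _ (measurable_scaledRisk β D).ennreal_ofReal]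
    calc ENNReal.ofReal r = ENNReal.ofReal (β / (2 * n)) * ENNReal.ofReal (2 * n / β * r) := by
          rw [← ENNReal.ofReal_mul (by positivity)]
          congr 1
          field_simp
      _ ≤ _ := by gcongr

theorem isHardInstance_of_scale_le {n p : ℕ} (hn : 0 < n)
    {L : EuclideanSpace ℝ (Fin p)} (hL : ∀ j, 0 < L j) {ε β : ℝ} (hε : 0 < ε) (hβ : 0 < β)
    (hp : 0 < p)
    (A : (Fin n → signBox L) → ProbabilityMeasure (EuclideanSpace ℝ (Fin p)))
    (D : Fin n → signBox L) {c k T : ℝ} (hc : 0 < c) (hk : 0 < k)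
    (hT : k * (‖L‖ * min (n : ℝ) (√(p : ℝ) / ε)) ≤ T)
    (h : ENNReal.ofReal (c * T) ≤ ∫⁻ w, ENNReal.ofReal (scaledRisk β D w)
      ∂(A D : Measure (EuclideanSpace ℝ (Fin p)))) :
    IsHardInstance L β A D
      (c * k / 2 * min (‖L‖ * β) (β * ‖L‖ * √(p : ℝ) / (n * ε))) := by
  have hn' : (0 : ℝ) < n := by exact_mod_cast hn
  have hp' : (0 : ℝ) < p := by exact_mod_cast hp
  have hLpos : 0 < ‖L‖ := norm_pos_iff.2 fun h0 => (hL ⟨0, hp⟩).ne' (by rw [h0]; rfl)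
  have hmin : min (‖L‖ * β) (β * ‖L‖ * √(p : ℝ) / (n * ε)) =
      β * ‖L‖ / n * min (n : ℝ) (√(p : ℝ) / ε) := by
    rw [mul_min_of_nonneg _ _ (by positivity)]
    congr 1 <;> field_simp
  have hpos : 0 < min (n : ℝ) (√(p : ℝ) / ε) := lt_min hn' (by positivity)
  rw [hmin]
  refine isHardInstance_of_le_lintegral_scaledRisk hn hL hβ A D (by positivity)
    ((ENNReal.ofReal_le_ofReal ?_).trans h)
  calc _ = c * (k * (‖L‖ * min (n : ℝ) (√(p : ℝ) / ε))) := by field_simp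
    _ ≤ c * T := by gcongr

/-! ### Coordinates of comparable size -/

/-- A spread vector has at least half of its coordinates of order `‖L‖ / √p`. -/
theorem IsSpread.card_filter {p : ℕ} {κ : ℝ} (hκ : 0 < κ) {L : EuclideanSpace ℝ (Fin p)}
    (hL : ∀ j, 0 < L j) (hp : 0 < p) (hs : IsSpread κ L) :
    (p : ℝ) / 2 ≤ ((Finset.univ.filter fun j =>
      κ * ‖L‖ / √(p : ℝ) ≤ L j ∧ L j ≤ 2 * ‖L‖ / √(p : ℝ)).card : ℝ) := by
  have hp' : (0 : ℝ) < p := by exact_mod_cast hp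
  have hLpos : 0 < ‖L‖ := norm_pos_iff.2 fun h0 => (hL ⟨0, hp⟩).ne' (by rw [h0]; rfl)
  set lo := Finset.univ.filter fun j => L j < κ * ‖L‖ / √(p : ℝ) with hlo
  set hi := Finset.univ.filter fun j => 2 * ‖L‖ / √(p : ℝ) < L j with hhi
  set J := Finset.univ.filter fun j =>
      κ * ‖L‖ / √(p : ℝ) ≤ L j ∧ L j ≤ 2 * ‖L‖ / √(p : ℝ) with hJ
  -- A larger set of small coordinates would carry less than `κ‖L‖`, contrary to spread. With at
  -- most `p/4` large ones, over half remain.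
  have hlo1 : (lo.card : ℝ) ≤ p / 75 := by
    by_contra! hcon
    have h1 := hs lo (Nat.ceil_le.2 hcon.le)
    have hne : lo.Nonempty := by
      rw [← Finset.card_pos]
      have : (0 : ℝ) < lo.card := lt_trans (by positivity) hcon
      exact_mod_cast this
    have h2 : ∑ j ∈ lo, L j ^ 2 < ∑ _j ∈ lo, (κ * ‖L‖ / √(p : ℝ)) ^ 2 :=
      Finset.sum_lt_sum_of_nonempty hne fun j hj =>
        pow_lt_pow_left₀ (Finset.mem_filter.1 hj).2 (hL j).le two_ne_zero
    have h3 : (lo.card : ℝ) ≤ p := by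
      have := lo.card_le_univ
      rw [Fintype.card_fin] at this
      exact_mod_cast this
    have h4 : ∑ _j ∈ lo, (κ * ‖L‖ / √(p : ℝ)) ^ 2 ≤ (κ * ‖L‖) ^ 2 := by
      rw [Finset.sum_const, nsmul_eq_mul, div_pow, Real.sq_sqrt hp'.le, mul_div_assoc',
        div_le_iff₀ hp', mul_comm]
      gcongr
    have h5 := (Real.le_sqrt (by positivity)
      (Finset.sum_nonneg fun j _ => sq_nonneg (L j))).1 h1
    linarith
  have hhi1 : (hi.card : ℝ) ≤ p / 4 := by
    have h1 : (hi.card : ℝ) * (2 * ‖L‖ / √(p : ℝ)) ^ 2 ≤ ∑ j ∈ hi, L j ^ 2 := by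
      rw [← nsmul_eq_mul]
      exact Finset.card_nsmul_le_sum _ _ _ fun j hj =>
        pow_le_pow_left₀ (by positivity) (Finset.mem_filter.1 hj).2.le 2
    have h2 : ∑ j ∈ hi, L j ^ 2 ≤ ‖L‖ ^ 2 := by
      rw [EuclideanSpace.real_norm_sq_eq]
      exact Finset.sum_le_univ_sum_of_nonneg fun j => sq_nonneg _
    have h3 := h1.trans h2
    rw [div_pow, Real.sq_sqrt hp'.le, mul_div_assoc', div_le_iff₀ hp'] at h3
    have h4 : ‖L‖ ^ 2 * (hi.card * 4) ≤ ‖L‖ ^ 2 * p := by linarith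
    have h5 := le_of_mul_le_mul_left h4 (by positivity)
    linarith
  have hcover : (Finset.univ : Finset (Fin p)) ⊆ J ∪ (lo ∪ hi) := by
    intro j _
    simp only [hJ, hlo, hhi, Finset.mem_union, Finset.mem_filter, Finset.mem_univ, true_and]
    by_cases h1 : κ * ‖L‖ / √(p : ℝ) ≤ L j
    · by_cases h2 : L j ≤ 2 * ‖L‖ / √(p : ℝ)
      · exact Or.inl ⟨h1, h2⟩
      · exact Or.inr (Or.inr (not_le.1 h2))
    · exact Or.inr (Or.inl (not_le.1 h1))
  have hcard : p ≤ J.card + (lo.card + hi.card) := by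
    calc p = (Finset.univ : Finset (Fin p)).card := by simp
      _ ≤ _ := Finset.card_le_card hcover
      _ ≤ _ := (Finset.card_union_le _ _).trans
        (Nat.add_le_add_left (Finset.card_union_le _ _) _)
  have hcard' : (p : ℝ) ≤ J.card + (lo.card + hi.card) := by exact_mod_cast hcard
  linarith

/-- Some dyadic level set carries a constant share of `p` times the least entry. -/
theorem exists_dyadic_level {p : ℕ} (hp : 0 < p) {L : Fin p → ℝ} {a : ℝ} (ha : 0 < a)
    (hL : ∀ j, a ≤ L j) :
    ∃ (lam : ℝ) (J : Finset (Fin p)), 0 < lam ∧ (∀ j ∈ J, lam ≤ L j ∧ L j ≤ 2 * lam) ∧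
      a * p / 2 ≤ lam * J.card := by
  have hex : ∀ j, ∃ k : ℕ, 2 ^ k * a ≤ L j ∧ L j < 2 ^ (k + 1) * a := fun j => by
    obtain ⟨k, h1, h2⟩ := exists_nat_pow_near (x := L j / a) (y := (2 : ℝ))
      ((one_le_div ha).2 (hL j)) (by norm_num)
    exact ⟨k, (le_div_iff₀ ha).1 h1, (div_lt_iff₀ ha).1 h2⟩
  choose k hk1 hk2 using hex
  by_contra! hcon
  set N := Finset.univ.sup k + 1 with hN
  have hkN : ∀ j, k j ∈ Finset.range N := fun j =>
    Finset.mem_range.2 (Nat.lt_succ_of_le (Finset.le_sup (Finset.mem_univ j)))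
  -- If every level failed, its size would be below `(p/2) 2⁻ⁱ`, and the geometric series would
  -- count fewer than `p` coordinates. The weight `2ⁱ` in the claim avoids a logarithmic loss.
  have hlevel : ∀ i : ℕ, ((Finset.univ.filter fun j => k j = i).card : ℝ) ≤
      p / 2 * (1 / 2) ^ i := by
    intro i
    have h := hcon (2 ^ i * a) (Finset.univ.filter fun j => k j = i) (by positivity)
      (fun j hj => by
        have hj' := (Finset.mem_filter.1 hj).2
        have h1 := hk1 j
        have h2 := hk2 j
        rw [hj'] at h1 h2
        exact ⟨h1, by rw [pow_succ] at h2; linarith⟩)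
    rw [one_div, inv_pow, ← div_eq_mul_inv, le_div_iff₀ (by positivity)]
    have h' : a * ((Finset.univ.filter fun j => k j = i).card * 2 ^ i) ≤ a * (p / 2) := by linarith
    exact le_of_mul_le_mul_left h' ha
  have hsum : (p : ℝ) = ∑ i ∈ Finset.range N,
      ((Finset.univ.filter fun j => k j = i).card : ℝ) := by
    have := Finset.card_eq_sum_card_fiberwise (s := (Finset.univ : Finset (Fin p))) (f := k)
      (t := Finset.range N) fun j _ => hkN j
    rw [Finset.card_univ, Fintype.card_fin] at this
    exact_mod_cast this
  have hp' : (0 : ℝ) < p := by exact_mod_cast hp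
  have hgeo : ∑ i ∈ Finset.range N, ((1 : ℝ) / 2) ^ i < 2 := by
    rw [geom_sum_eq (by norm_num)]
    have : (0 : ℝ) < (1 / 2) ^ N := by positivity
    rw [div_lt_iff_of_neg (by norm_num)]
    linarith
  have : (p : ℝ) < p := by
    calc (p : ℝ) ≤ ∑ i ∈ Finset.range N, (p : ℝ) / 2 * (1 / 2) ^ i := by
          conv_lhs => rw [hsum]
          exact Finset.sum_le_sum fun i _ => hlevel i
      _ = p / 2 * ∑ i ∈ Finset.range N, ((1 : ℝ) / 2) ^ i := by rw [Finset.mul_sum]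
      _ < p / 2 * 2 := by gcongr
      _ = p := by ring
  exact lt_irrefl _ this

theorem norm_le_sqrt_mul_iSup {p : ℕ} {L : EuclideanSpace ℝ (Fin p)} (hL : ∀ j, 0 < L j)
    (hp : 0 < p) : ‖L‖ ≤ √(p : ℝ) * ⨆ j, L j := by
  have hle : ∀ j, L j ≤ ⨆ j, L j := le_ciSup (Set.finite_range _).bddAbove
  have h0 : 0 ≤ ⨆ j, L j := (hL ⟨0, hp⟩).le.trans (hle _)
  rw [EuclideanSpace.norm_eq, Real.sqrt_le_left (by positivity), mul_pow,
    Real.sq_sqrt (Nat.cast_nonneg _)]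
  calc ∑ j, ‖L j‖ ^ 2 ≤ ∑ _j : Fin p, (⨆ j, L j) ^ 2 := by
        refine Finset.sum_le_sum fun j _ => ?_
        rw [Real.norm_of_nonneg (hL j).le]
        exact pow_le_pow_left₀ (hL j).le (hle j) 2
    _ = _ := by simp

/-! ### The two lower bounds -/

theorem mainTheorem3 (ε₀ : ℝ) (hε₀ : 0 < ε₀) :
    (∀ κ : ℝ, 0 < κ → ∃ c : ℝ, 0 < c ∧ ∃ c' : ℝ, 0 < c' ∧
      ∀ (n p : ℕ), 0 < n → 0 < p →
      ∀ L : EuclideanSpace ℝ (Fin p), (∀ j, 0 < L j) → IsSpread κ L →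
      ∀ ε δ β : ℝ, 0 < ε → ε ≤ ε₀ → 0 ≤ δ → δ ≤ c' / n → 0 < β →
      ∀ A : (Fin n → signBox L) → ProbabilityMeasure (EuclideanSpace ℝ (Fin p)),
        IsDifferentiallyPrivate ε δ A →
        ∃ D : Fin n → signBox L,
          IsHardInstance L β A D
            (c * min (‖L‖ * β) (β * ‖L‖ * √(p : ℝ) / (n * ε)))) ∧
    (∃ c : ℝ, 0 < c ∧ ∃ c' : ℝ, 0 < c' ∧
      ∀ (n p : ℕ), 0 < n → 0 < p →
      ∀ L : EuclideanSpace ℝ (Fin p), (∀ j, 0 < L j) →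
      ∀ ε δ β : ℝ, 0 < ε → ε ≤ ε₀ → 0 ≤ δ → δ ≤ c' / n → 0 < β →
      ∀ A : (Fin n → signBox L) → ProbabilityMeasure (EuclideanSpace ℝ (Fin p)),
        IsDifferentiallyPrivate ε δ A →
        ∃ D : Fin n → signBox L,
          IsHardInstance L β A D
            (c * (((⨅ j, L j) / (⨆ j, L j)) *
              min (‖L‖ * β) (β * ‖L‖ * √(p : ℝ) / (n * ε))))) := by
  constructor
  · intro κ hκ
    set R := max 1 (2 / κ) with hR
    obtain ⟨c, hc, H⟩ := exists_forall_le_lintegral_scaledRisk hε₀ (le_max_left 1 (2 / κ))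
    refine ⟨c * (κ / 2) / 2, by positivity, 1 / (192 * Real.exp ε₀), by positivity, ?_⟩
    intro n p hn hp L hL hs ε δ β hε hεε hδ hδn hβ A hA
    have hp' : (0 : ℝ) < p := by exact_mod_cast hp
    have hn' : (0 : ℝ) < n := by exact_mod_cast hn
    have hLpos : 0 < ‖L‖ := norm_pos_iff.2 fun h0 => (hL ⟨0, hp⟩).ne' (by rw [h0]; rfl)
    have hcard := hs.card_filter hκ hL hp
    set J := Finset.univ.filter fun j =>
      κ * ‖L‖ / √(p : ℝ) ≤ L j ∧ L j ≤ 2 * ‖L‖ / √(p : ℝ) with hJ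
    have hJne : J.Nonempty := by
      rw [← Finset.card_pos]
      have : (0 : ℝ) < J.card := lt_of_lt_of_le (by positivity) hcard
      exact_mod_cast this
    obtain ⟨D, hD⟩ := H n p hn L hL J (κ * ‖L‖ / √(p : ℝ)) hJne (by positivity)
      (fun j hj => by
        obtain ⟨h1, h2⟩ := (Finset.mem_filter.1 hj).2
        refine ⟨h1, h2.trans ?_⟩
        calc 2 * ‖L‖ / √(p : ℝ) = 2 / κ * (κ * ‖L‖ / √(p : ℝ)) := by field_simp
          _ ≤ _ := by
            gcongr
            exact le_max_right _ _) ε δ β hε hεε hδ hδn A hA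
    refine ⟨D, isHardInstance_of_scale_le hn hL hε hβ hp A D hc (by positivity) ?_ hD⟩
    have hq : √(p : ℝ) / 2 * √(p : ℝ) ≤ √(J.card : ℝ) * √(J.card : ℝ) := by
      rw [div_mul_eq_mul_div, Real.mul_self_sqrt hp'.le, Real.mul_self_sqrt (Nat.cast_nonneg _)]
      exact hcard
    have hqp : √(J.card : ℝ) ≤ √(p : ℝ) := by
      refine Real.sqrt_le_sqrt ?_
      have := J.card_le_univ
      rw [Fintype.card_fin] at this
      exact_mod_cast this
    -- `|J| ≥ p/2` handles the branch `√p/ε` of the minimum; with `|J| ≤ p` it also gives this bound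
    -- for the branch `n`.
    have hq2 : √(p : ℝ) / 2 ≤ √(J.card : ℝ) := by
      have h1 : √(J.card : ℝ) * √(J.card : ℝ) ≤ √(J.card : ℝ) * √(p : ℝ) := by gcongr
      exact le_of_mul_le_mul_right (hq.trans h1) (Real.sqrt_pos.2 hp')
    have hsp : 0 < √(p : ℝ) := Real.sqrt_pos.2 hp'
    calc κ / 2 * (‖L‖ * min (n : ℝ) (√(p : ℝ) / ε))
        = κ * ‖L‖ / √(p : ℝ) * min (√(p : ℝ) / 2 * n) (√(p : ℝ) / 2 * √(p : ℝ) / ε) := by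
          rw [mul_div_assoc (√(p : ℝ) / 2), ← mul_min_of_nonneg _ _ (by positivity)]
          field_simp
      _ ≤ κ * ‖L‖ / √(p : ℝ) *
          min (√(J.card : ℝ) * n) (√(J.card : ℝ) * √(J.card : ℝ) / ε) := by
          gcongr
      _ = _ := by
          rw [mul_div_assoc (√(J.card : ℝ)), ← mul_min_of_nonneg _ _ (by positivity), mul_assoc]
  · obtain ⟨c, hc, H⟩ := exists_forall_le_lintegral_scaledRisk hε₀ (one_le_two)
    refine ⟨c * (1 / 2) / 2, by positivity, 1 / (192 * Real.exp ε₀), by positivity, ?_⟩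
    intro n p hn hp L hL ε δ β hε hεε hδ hδn hβ A hA
    have hp' : (0 : ℝ) < p := by exact_mod_cast hp
    have hn' : (0 : ℝ) < n := by exact_mod_cast hn
    have : Nonempty (Fin p) := ⟨⟨0, hp⟩⟩
    have hmin : 0 < ⨅ j, L j := by
      obtain ⟨j, hj⟩ := exists_eq_ciInf_of_finite (f := fun j => L j)
      rw [← hj]; exact hL j
    have hmax : 0 < ⨆ j, L j :=
      (hL ⟨0, hp⟩).trans_le (le_ciSup (f := fun j => L j) (Set.finite_range _).bddAbove _)
    obtain ⟨lam, J, hlam, hJ, hcard⟩ := exists_dyadic_level hp hmin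
      fun j => ciInf_le (f := fun j => L j) (Set.finite_range _).bddBelow j
    have hJne : J.Nonempty := by
      rw [← Finset.card_pos]
      have : 0 < lam * (J.card : ℝ) := lt_of_lt_of_le (by positivity) hcard
      have := pos_of_mul_pos_right this hlam.le
      exact_mod_cast this
    obtain ⟨D, hD⟩ := H n p hn L hL J lam hJne hlam hJ ε δ β hε hεε hδ hδn A hA
    refine ⟨D, ?_⟩
    have hrew : c * (1 / 2) / 2 * ((⨅ j, L j) / (⨆ j, L j) *
        min (‖L‖ * β) (β * ‖L‖ * √(p : ℝ) / (n * ε))) =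
        c * ((⨅ j, L j) / (⨆ j, L j) / 2) / 2 *
          min (‖L‖ * β) (β * ‖L‖ * √(p : ℝ) / (n * ε)) := by ring
    rw [hrew]
    refine isHardInstance_of_scale_le hn hL hε hβ hp A D hc (by positivity) ?_ hD
    have hsp : 0 < √(p : ℝ) := Real.sqrt_pos.2 hp'
    have hqp : √(J.card : ℝ) ≤ √(p : ℝ) := by
      refine Real.sqrt_le_sqrt ?_
      have := J.card_le_univ
      rw [Fintype.card_fin] at this
      exact_mod_cast this
    have hq : (⨅ j, L j) * √(p : ℝ) / 2 * √(p : ℝ) ≤ lam * √(J.card : ℝ) * √(J.card : ℝ) := by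
      have h1 := Real.mul_self_sqrt hp'.le
      have h2 := Real.mul_self_sqrt (Nat.cast_nonneg (α := ℝ) J.card)
      calc _ = (⨅ j, L j) * p / 2 := by
            rw [div_mul_eq_mul_div, mul_assoc, h1]
        _ ≤ _ := by rw [mul_assoc, h2]; exact hcard
    -- `J` may be much smaller than `p`; only `lam |J| ≥ Lmin p / 2` is known, and dividing by `√|J|
    -- ≤ √p` settles the branch `n`.
    have hq2 : (⨅ j, L j) * √(p : ℝ) / 2 ≤ lam * √(J.card : ℝ) := by
      have h1 : lam * √(J.card : ℝ) * √(J.card : ℝ) ≤ lam * √(J.card : ℝ) * √(p : ℝ) := by gcongr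
      exact le_of_mul_le_mul_right (hq.trans h1) hsp
    have hmn : 0 ≤ min (n : ℝ) (√(p : ℝ) / ε) := by positivity
    calc (⨅ j, L j) / (⨆ j, L j) / 2 * (‖L‖ * min (n : ℝ) (√(p : ℝ) / ε))
        ≤ (⨅ j, L j) / (⨆ j, L j) / 2 *
            ((√(p : ℝ) * ⨆ j, L j) * min (n : ℝ) (√(p : ℝ) / ε)) := by
          gcongr
          exact norm_le_sqrt_mul_iSup hL hp
      _ = min ((⨅ j, L j) * √(p : ℝ) / 2 * n)
            ((⨅ j, L j) * √(p : ℝ) / 2 * √(p : ℝ) / ε) := by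
          rw [mul_div_assoc ((⨅ j, L j) * √(p : ℝ) / 2), ← mul_min_of_nonneg _ _ (by positivity)]
          field_simp
      _ ≤ min (lam * √(J.card : ℝ) * n) (lam * √(J.card : ℝ) * √(J.card : ℝ) / ε) := by
          gcongr
      _ = _ := by
          rw [mul_div_assoc (lam * √(J.card : ℝ)), ← mul_min_of_nonneg _ _ (by positivity)]
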